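/- Let $n,k\ge 1$ be integers, let $\Sigma$ be a set of $n$ tape symbols and $Q$ a set of $k$ states. A (moving head) Turing machine is a map $T_f$ of $\Sigma^{\mathbb Z}\times Q\times\mathbb Z$ to itself given by a local rule $f\colon \Sigma^{F_{\mathrm{in}}}\times Q\to\Sigma^{F_{\mathrm{out}}}\times Q\times\mathbb Z$ with $F_{\mathrm{in}},F_{\mathrm{out}}\subset\mathbb Z$ finite, as follows: for $(x,q,v)\in\Sigma^{\mathbb Z}\times Q\times\mathbb Z$ let $p=(x_{v+u})_{u\in F_{\mathrm{in}}}$ and $f(p,q)=(\tilde p,\tilde q,\tilde u)$; then $T_f(x,q,v)=(\tilde x,\tilde q,v+\tilde u)$, where $\tilde x_u=\tilde p_{u-v}$ if $u-v\in F_{\mathrm{out}}$ and $\tilde x_u=x_u$ otherwise. Let $\mathrm{RTM}(\mathbb Z,n,k)$ be the group, under composition, of the bijective Turing machines whose inverse is also a Turing machine. Let $\mathrm{RFA}(\mathbb Z,n,k)$ (the reversible finite-state automata) be its subgroup of machines that never change the tape, let $\mathrm{LP}(\mathbb Z,n,k)$ (the local permutations) be its subgroup of machines that never move the head, and let $$\mathrm{EL}(\mathbb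 Z,n,k)=\langle \mathrm{RFA}(\mathbb Z,n,k),\ \mathrm{LP}(\mathbb Z,n,k)\rangle$$ be the group of elementary Turing machines. Theorem. For all integers $n,k\ge 1$, the group $\mathrm{EL}(\mathbb Z,n,k)$ is finitely generated. -/

import Mathlib

namespace MovingHead

/-- Bi-infinite tapes `Σ^ℤ` over the alphabet `Σ = {0, …, n-1}`. -/
abbrev Tape (n : ℕ) : Type := ℤ → Fin n

/-- Configurations `(x, q, v)` of the moving head model: a tape `x`, a state `q` (one of `k`)
and the position `v` of the head. -/
abbrev Config (n k : ℕ) : Type := Tape n × Fin k × ℤ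

/-- A local rule `f : Σ^{F_in} × Q → Σ^{F_out} × Q × ℤ` with `F_in`, `F_out` finite subsets
of `ℤ`. -/
structure LocalRule (n k : ℕ) where
  inSupp : Finset ℤ
  outSupp : Finset ℤ
  rule : (inSupp → Fin n) × Fin k → (outSupp → Fin n) × Fin k × ℤ

/-- The value of a local rule at the configuration `(x, q, v)`: the pattern that is read is
the one seen from the head, `p u = x (v + u)` for `u ∈ F_in`. -/
def LocalRule.eval {n k : ℕ} (f : LocalRule n k) (c : Config n k) :
    (f.outSupp → Fin n) × Fin k × ℤ :=
  f.rule (fun u => c.1 (c.2.2 + (u : ℤ)), c.2.1)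

/-- The map `T_f` on configurations defined by the local rule `f`: overwrite the tape on
`v + F_out`, change the state, and move the head by the vector given by the rule. -/
def LocalRule.toMap {n k : ℕ} (f : LocalRule n k) (c : Config n k) : Config n k :=
  (fun u => if h : u - c.2.2 ∈ f.outSupp then (f.eval c).1 ⟨u - c.2.2, h⟩ else c.1 u,
    (f.eval c).2.1,
    c.2.2 + (f.eval c).2.2)

/-- `T` is a moving head `(ℤ, n, k)`-Turing machine. -/
def IsTuringMachine {n k : ℕ} (T : Config n k → Config n k) : Prop :=
  ∃ f : LocalRule n k, T = f.toMap

/-- Auxiliary: `T` only sees and modifies the tape in a finite window around the head. -/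
theorem isTuringMachine_of_window {n k : ℕ} {T : Config n k → Config n k} (W : Finset ℤ)
    (hout : ∀ c u, u - c.2.2 ∉ W → (T c).1 u = c.1 u)
    (hin : ∀ c c' : Config n k, (∀ w ∈ W, c.1 (c.2.2 + w) = c'.1 (c'.2.2 + w)) →
      c.2.1 = c'.2.1 →
        (∀ w ∈ W, (T c).1 (c.2.2 + w) = (T c').1 (c'.2.2 + w)) ∧
        (T c).2.1 = (T c').2.1 ∧ (T c).2.2 - c.2.2 = (T c').2.2 - c'.2.2) :
    IsTuringMachine T := by
  rcases isEmpty_or_nonempty (Config n k) with he | ⟨⟨c0⟩⟩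
  · refine ⟨⟨∅, ∅, fun a => (fun u => absurd u.2 (Finset.notMem_empty _), a.2, 0)⟩, ?_⟩
    funext c
    exact he.elim c
  · let ext : (W → Fin n) × Fin k → Config n k := fun a =>
      (fun u => if h : u ∈ W then a.1 ⟨u, h⟩ else c0.1 u, a.2, 0)
    refine ⟨⟨W, W, fun a => (fun w => (T (ext a)).1 w, (T (ext a)).2.1, (T (ext a)).2.2)⟩, ?_⟩
    funext c
    obtain ⟨h1, h2, h3⟩ := hin c (ext (fun u => c.1 (c.2.2 + (u : ℤ)), c.2.1))
      (by intro w hw; simp [ext, hw]) rfl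
    refine Prod.ext ?_ (Prod.ext ?_ ?_)
    · funext u
      by_cases h : u - c.2.2 ∈ W
      · have := h1 _ h
        simp only [LocalRule.toMap, LocalRule.eval, h, dif_pos]
        simpa [ext] using this
      · simp only [LocalRule.toMap, h, dif_neg, not_false_eq_true]
        exact hout c u h
    · exact h2
    · have h3' : (T c).2.2 - c.2.2 =
          (T (ext (fun u => c.1 (c.2.2 + (u : ℤ)), c.2.1))).2.2 := by
        rw [h3]; simp [ext]
      simp only [LocalRule.toMap, LocalRule.eval]
      rw [← h3']; ring

theorem isTuringMachine_id {n k : ℕ} : IsTuringMachine (id : Config n k → Config n k) :=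
  isTuringMachine_of_window ∅ (by simp) (by simp)

theorem IsTuringMachine.comp {n k : ℕ} {S T : Config n k → Config n k}
    (hS : IsTuringMachine S) (hT : IsTuringMachine T) : IsTuringMachine (S ∘ T) := by
  classical
  obtain ⟨g, rfl⟩ := hS
  obtain ⟨f, rfl⟩ := hT
  let M : Finset ℤ := Finset.univ.image (fun a => (f.rule a).2.2)
  let W : Finset ℤ := (f.inSupp ∪ f.outSupp) ∪
    Finset.image₂ (fun a b => a + b) M (g.inSupp ∪ g.outSupp)
  have hM : ∀ c, (f.eval c).2.2 ∈ M := fun c =>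
    Finset.mem_image_of_mem (fun a => (f.rule a).2.2) (Finset.mem_univ _)
  have hWi : ∀ w ∈ f.inSupp, w ∈ W := fun w hw => by simp [W, hw]
  have hWo : ∀ w ∈ f.outSupp, w ∈ W := fun w hw => by simp [W, hw]
  have hWg : ∀ m ∈ M, ∀ w ∈ g.inSupp ∪ g.outSupp, m + w ∈ W := fun m hm w hw =>
    Finset.mem_union_right _ (Finset.mem_image₂_of_mem hm hw)
  refine isTuringMachine_of_window W ?_ ?_
  · intro c u hu
    have h1 : u - c.2.2 ∉ f.outSupp := fun h => hu (hWo _ h)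
    have h2 : u - (f.toMap c).2.2 ∉ g.outSupp := fun h => hu (by
      have := hWg _ (hM c) _ (Finset.mem_union_right _ h)
      have e : (f.eval c).2.2 + (u - (f.toMap c).2.2) = u - c.2.2 := by
        simp only [LocalRule.toMap]; ring
      rwa [e] at this)
    have e1 : (g.toMap (f.toMap c)).1 u = (f.toMap c).1 u := by
      conv_lhs => simp only [LocalRule.toMap]
      exact dif_neg h2
    have e2 : (f.toMap c).1 u = c.1 u := by
      simp only [LocalRule.toMap]
      exact dif_neg h1
    exact e1.trans e2
  · intro c c' hc hq
    have he : f.eval c = f.eval c' := by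
      unfold LocalRule.eval
      rw [hq]
      congr 2
      funext u
      exact hc _ (hWi _ u.2)
    have hft : ∀ w ∈ W, (f.toMap c).1 (c.2.2 + w) = (f.toMap c').1 (c'.2.2 + w) := by
      intro w hw
      simp only [LocalRule.toMap, add_sub_cancel_left, he, hc w hw]
    have hge : g.eval (f.toMap c) = g.eval (f.toMap c') := by
      have hs : (f.toMap c).2.1 = (f.toMap c').2.1 := by simp only [LocalRule.toMap, he]
      unfold LocalRule.eval
      rw [hs]
      congr 2
      funext u
      have := hft _ (hWg _ (hM c) _ (Finset.mem_union_left _ u.2))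
      simp only [← add_assoc] at this
      rw [show (f.toMap c).2.2 = c.2.2 + (f.eval c).2.2 from rfl,
        show (f.toMap c').2.2 = c'.2.2 + (f.eval c).2.2 by rw [he]; rfl]
      exact this
    refine ⟨?_, ?_, ?_⟩
    · intro w hw
      have p1 : c.2.2 + w - (f.toMap c).2.2 = w - (f.eval c).2.2 := by
        simp only [LocalRule.toMap]; ring
      have p2 : c'.2.2 + w - (f.toMap c').2.2 = w - (f.eval c).2.2 := by
        rw [he]; simp only [LocalRule.toMap]; ring
      have key : ∀ d : Config n k, (g.toMap d).1 = fun u =>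
          if h : u - d.2.2 ∈ g.outSupp then (g.eval d).1 ⟨u - d.2.2, h⟩ else d.1 u :=
        fun _ => rfl
      simp only [Function.comp_apply, key, p1, p2, hge, hft w hw]
    · simp only [Function.comp_apply]
      exact congrArg (fun a => a.2.1) hge
    · have k1 : ∀ d : Config n k, (g.toMap (f.toMap d)).2.2 - d.2.2 =
          (f.eval d).2.2 + (g.eval (f.toMap d)).2.2 := by
        intro d
        rw [show (g.toMap (f.toMap d)).2.2 =
          d.2.2 + (f.eval d).2.2 + (g.eval (f.toMap d)).2.2 from rfl]
        ring
      simp only [Function.comp_apply, k1, he, hge]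

/-- The group `RTM(ℤ, n, k)` of reversible Turing machines: the bijections `T` such that both
`T` and its inverse are Turing machines, under composition. -/
def RTM (n k : ℕ) : Subgroup (Equiv.Perm (Config n k)) where
  carrier := {T | IsTuringMachine (T : Config n k → Config n k) ∧
    IsTuringMachine (T.symm : Config n k → Config n k)}
  one_mem' := ⟨isTuringMachine_id, isTuringMachine_id⟩
  mul_mem' := fun hS hT => ⟨hS.1.comp hT.1, hT.2.comp hS.2⟩
  inv_mem' := fun hT => ⟨hT.2, hT.1⟩

/-- The group `LP(ℤ, n, k)` of local permutations: reversible Turing machines that never move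
the head. -/
def LP (n k : ℕ) : Subgroup (Equiv.Perm (Config n k)) where
  carrier := {T | T ∈ RTM n k ∧ ∀ c, (T c).2.2 = c.2.2}
  one_mem' := ⟨one_mem _, fun _ => rfl⟩
  mul_mem' := fun {S T} hS hT => ⟨mul_mem hS.1 hT.1, fun c => (hS.2 (T c)).trans (hT.2 c)⟩
  inv_mem' := fun {T} hT => ⟨inv_mem hT.1, fun c => by
    have h := hT.2 (T⁻¹ c)
    rw [show T (T⁻¹ c) = c from T.apply_symm_apply c] at h
    exact h.symm⟩

/-- The group `RFA(ℤ, n, k)` of reversible finite-state automata: reversible Turing machines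
that never change the tape. -/
def RFA (n k : ℕ) : Subgroup (Equiv.Perm (Config n k)) where
  carrier := {T | T ∈ RTM n k ∧ ∀ c, (T c).1 = c.1}
  one_mem' := ⟨one_mem _, fun _ => rfl⟩
  mul_mem' := fun {S T} hS hT => ⟨mul_mem hS.1 hT.1, fun c => (hS.2 (T c)).trans (hT.2 c)⟩
  inv_mem' := fun {T} hT => ⟨inv_mem hT.1, fun c => by
    have h := hT.2 (T⁻¹ c)
    rw [show T (T⁻¹ c) = c from T.apply_symm_apply c] at h
    exact h.symm⟩

/-- The group `EL(ℤ, n, k)` of elementary Turing machines, generated by the reversible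
finite-state automata and the local permutations. -/
def EL (n k : ℕ) : Subgroup (Equiv.Perm (Config n k)) :=
  Subgroup.closure ((RFA n k : Set (Equiv.Perm (Config n k))) ∪ (LP n k))

end MovingHead

/-! Order the pairs (position, state) lexicographically, that is, encode them by the integer `k * v
+ q`. A tape-preserving machine then slides each configuration along ℤ by a bounded displacement
that depends only on the state and the tape near the head, and `step` is the slide by 1. The
generators are `step`, the permutations of the patterns in one window of four cells, and, for each
pair of symbols `a b`, the involution exchanging `c` with `step c` for all `c` in `basic a b`.

Automata (`mem_of_isLocal_disp`): every automaton is a product of powers of `step` and adjacent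
swaps `adjSwap (step n k) P` with `P` local and disjoint from its translate. The maximal
displacement is lowered by swapping at the ends of the runs on which it is attained. This terminates
unless a run is long, and then the automaton is a power of `step` (`disp_eq_of_run`).

Local permutations (`LP_le`): even permutations of two overlapping windows generate all even
permutations of their union, by commutators of controlled permutations. Odd permutations are dealt
with by the parity of `n`: adding a cell raises the sign to the power `n`.

Adjacent swaps (`adjSwap_mem`): cut `P` into cylinders. If the state is not the last one, the swap
is a local permutation. Otherwise a translation puts the cylinder inside some `basic a b`. Comparing
the basic swap with its conjugate by a local permutation isolates the product of the swap on the
cylinder and the swap on a fixed marker cylinder, and a parity count, again according to the parity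
of `n`, removes the marker. -/

namespace MovingHead

/-! ### Swaps along a permutation -/

section AdjSwap

variable {X : Type*}

/-- `P` is disjoint from its translate by `N`. -/
def Separated (N : Equiv.Perm X) (P : Set X) : Prop := ∀ c ∈ P, N c ∉ P

theorem Separated.mono {N : Equiv.Perm X} {P Q : Set X} (h : Separated N Q) (hPQ : P ⊆ Q) :
    Separated N P := fun c hc hc' => h c (hPQ hc) (hPQ hc')

open Classical in
/-- The involution that exchanges `c` and `N c` for all `c ∈ P` (the identity if `P` is not
separated). -/
noncomputable def adjSwap (N : Equiv.Perm X) (P : Set X) : Equiv.Perm X :=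
  if h : Separated N P then
    Function.Involutive.toPerm
      (fun c => if c ∈ P then N c else if N.symm c ∈ P then N.symm c else c) (by
        intro c
        by_cases h1 : c ∈ P
        · simp [h1, h c h1]
        · by_cases h2 : N.symm c ∈ P
          · simp [h1, h2]
          · simp [h1, h2])
  else 1

variable {N : Equiv.Perm X} {P Q : Set X}

open Classical in
theorem adjSwap_apply (h : Separated N P) (c : X) :
    adjSwap N P c = if c ∈ P then N c else if N.symm c ∈ P then N.symm c else c := by
  rw [adjSwap, dif_pos h]; rfl

theorem adjSwap_of_mem (h : Separated N P) {c : X} (hc : c ∈ P) : adjSwap N P c = N c := by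
  rw [adjSwap_apply h, if_pos hc]

theorem adjSwap_of_symm_mem (h : Separated N P) {c : X} (hc : N.symm c ∈ P) :
    adjSwap N P c = N.symm c := by
  have : c ∉ P := fun h' => h _ hc (by simpa using h')
  rw [adjSwap_apply h, if_neg this, if_pos hc]

theorem adjSwap_of_notMem {c : X} (hc : c ∉ P) (hc' : N.symm c ∉ P) :
    adjSwap N P c = c := by
  by_cases h : Separated N P
  · rw [adjSwap_apply h, if_neg hc, if_neg hc']
  · rw [adjSwap, dif_neg h]; rfl

theorem adjSwap_mul_self (N : Equiv.Perm X) (P : Set X) : adjSwap N P * adjSwap N P = 1 := by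
  by_cases h : Separated N P
  · ext c
    by_cases h1 : c ∈ P
    · simp [adjSwap_of_mem h h1, adjSwap_of_symm_mem h (c := N c) (by simpa using h1)]
    · by_cases h2 : N.symm c ∈ P
      · simp [adjSwap_of_symm_mem h h2, adjSwap_of_mem h h2]
      · simp [adjSwap_of_notMem h1 h2]
  · rw [adjSwap, dif_neg h, mul_one]

theorem adjSwap_inv (N : Equiv.Perm X) (P : Set X) : (adjSwap N P)⁻¹ = adjSwap N P :=
  inv_eq_of_mul_eq_one_left (adjSwap_mul_self N P)

theorem adjSwap_empty (N : Equiv.Perm X) : adjSwap N ∅ = 1 := by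
  ext c
  exact adjSwap_of_notMem (by simp) (by simp)

theorem adjSwap_union (h : Separated N (P ∪ Q)) (hd : Disjoint P Q) :
    adjSwap N (P ∪ Q) = adjSwap N P * adjSwap N Q := by
  classical
  have hP : Separated N P := h.mono Set.subset_union_left
  have hQ : Separated N Q := h.mono Set.subset_union_right
  have hd' : ∀ c, c ∈ P → c ∉ Q := fun c h1 h2 => Set.disjoint_left.1 hd h1 h2
  ext c
  rw [Equiv.Perm.mul_apply, adjSwap_apply h]
  by_cases h1 : c ∈ Q
  · rw [if_pos (Set.mem_union_right P h1), adjSwap_of_mem hQ h1, adjSwap_of_notMem]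
    · exact fun h' => h c (Or.inr h1) (Or.inl h')
    · simpa using fun h' => hd' c h' h1
  by_cases h2 : N.symm c ∈ Q
  · have h3 : c ∉ P := fun h' => h _ (Or.inr h2) (by simpa using Or.inl h')
    rw [if_neg (by simp [h1, h3]), if_pos (Set.mem_union_right P h2), adjSwap_of_symm_mem hQ h2,
      adjSwap_of_notMem]
    · exact fun h' => hd' _ h' h2
    · intro h'
      exact h _ (Or.inl h') (by simpa using Or.inr h2)
  rw [adjSwap_of_notMem h1 h2, adjSwap_apply hP]
  simp [h1, h2]

theorem adjSwap_commute (h : Separated N (P ∪ Q)) (hd : Disjoint P Q) :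
    Commute (adjSwap N P) (adjSwap N Q) := by
  have := adjSwap_union h hd
  rw [Set.union_comm, adjSwap_union (Set.union_comm P Q ▸ h) hd.symm] at this
  exact this.symm

/-- Conjugation of an adjacent swap by a permutation that commutes with `N` on `P`. -/
theorem conj_adjSwap {M : Equiv.Perm X} (hP : Separated N P) (hQ : Separated N (M '' P))
    (hM : ∀ c ∈ P, M (N c) = N (M c)) :
    M * adjSwap N P * M⁻¹ = adjSwap N (M '' P) := by
  ext c
  obtain ⟨c, rfl⟩ := M.surjective c
  rw [Equiv.Perm.mul_apply, Equiv.Perm.mul_apply,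
    show M⁻¹ (M c) = c from M.symm_apply_apply c]
  by_cases h1 : c ∈ P
  · rw [adjSwap_of_mem hP h1, adjSwap_of_mem hQ (Set.mem_image_of_mem _ h1), hM c h1]
  by_cases h2 : N.symm c ∈ P
  · have h3 := hM _ h2
    rw [Equiv.apply_symm_apply] at h3
    rw [adjSwap_of_symm_mem hP h2, h3, adjSwap_of_symm_mem hQ, Equiv.symm_apply_apply]
    simpa using h2
  · rw [adjSwap_of_notMem h1 h2, adjSwap_of_notMem]
    · simpa using h1
    · rintro ⟨d, hd, hd'⟩
      rw [Equiv.eq_symm_apply, ← hM d hd, M.injective.eq_iff] at hd'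
      exact h2 (by rwa [← hd', Equiv.symm_apply_apply])

theorem conj_adjSwap_of_commute {M : Equiv.Perm X} (hP : Separated N P) (hM : Commute M N) :
    M * adjSwap N P * M⁻¹ = adjSwap N (M '' P) := by
  have hM' : ∀ c, M (N c) = N (M c) := fun c => congrArg (fun f : Equiv.Perm X => f c) hM.eq
  refine conj_adjSwap hP ?_ fun c _ => hM' c
  rintro _ ⟨c, hc, rfl⟩ ⟨d, hd, h⟩
  rw [← hM', M.injective.eq_iff] at h
  exact hP c hc (h ▸ hd)

theorem commute_adjSwap_of_fix {M : Equiv.Perm X}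
    (hM : ∀ c ∈ P, M c = c) (hM' : ∀ c ∈ P, M (N c) = N c) :
    Commute M (adjSwap N P) := by
  by_cases hP : Separated N P
  · have himg : M '' P = P := by
      ext c
      refine ⟨?_, fun hc => ⟨c, hc, hM c hc⟩⟩
      rintro ⟨d, hd, rfl⟩
      rwa [hM d hd]
    have := conj_adjSwap (M := M) hP (himg.symm ▸ hP) fun c hc => by rw [hM' c hc, hM c hc]
    rw [himg] at this
    exact mul_inv_eq_iff_eq_mul.1 this
  · rw [adjSwap, dif_neg hP]
    exact Commute.one_right M

/-- Membership of the adjacent swap of a disjoint union, up to a power of a commuting element. -/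
theorem adjSwap_biUnion_mul_pow_mem {ι : Type*} (G : Subgroup (Equiv.Perm X))
    (t : Equiv.Perm X) (B : Finset ι) (p : ι → Set X)
    (hsep : Separated N (⋃ i ∈ B, p i)) (hd : Pairwise (Function.onFun Disjoint p))
    (ht : ∀ i ∈ B, Commute (adjSwap N (p i)) t) (hG : ∀ i ∈ B, adjSwap N (p i) * t ∈ G) :
    adjSwap N (⋃ i ∈ B, p i) * t ^ B.card ∈ G := by
  classical
  induction B using Finset.induction_on with
  | empty => simp [adjSwap_empty, one_mem]
  | insert i B hi ih =>
    rw [Finset.set_biUnion_insert] at hsep ⊢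
    have hd' : Disjoint (p i) (⋃ j ∈ B, p j) := by
      rw [Set.disjoint_iUnion₂_right]
      intro j hj
      exact hd (fun h => hi (h ▸ hj))
    have h1 := ih (hsep.mono Set.subset_union_right) (fun j hj => ht j (Finset.mem_insert_of_mem hj))
      (fun j hj => hG j (Finset.mem_insert_of_mem hj))
    have h2 := hG i (Finset.mem_insert_self i B)
    have hc := ht i (Finset.mem_insert_self i B)
    have h12 := mul_mem h1 h2
    rw [adjSwap_union hsep hd', (adjSwap_commute hsep hd').eq, Finset.card_insert_of_notMem hi,
      pow_succ]
    convert h12 using 1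
    rw [mul_assoc, mul_assoc, ← mul_assoc (adjSwap N (p i)), (hc.pow_right _).eq, mul_assoc]

theorem adjSwap_biUnion_mem {ι : Type*} (G : Subgroup (Equiv.Perm X)) (B : Finset ι)
    (p : ι → Set X) (hsep : Separated N (⋃ i ∈ B, p i))
    (hd : Pairwise (Function.onFun Disjoint p)) (hG : ∀ i ∈ B, adjSwap N (p i) ∈ G) :
    adjSwap N (⋃ i ∈ B, p i) ∈ G := by
  simpa using adjSwap_biUnion_mul_pow_mem G 1 B p hsep hd (fun _ _ => Commute.one_right _)
    (by simpa using hG)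

/-- From the swap on `Q` and an involution `r` exchanging `P ⊆ Q` with `P'`, obtain the product
of the swaps on `P` and on `P'`. -/
theorem adjSwap_mul_adjSwap_mem {P' : Set X} {G : Subgroup (Equiv.Perm X)} {r : Equiv.Perm X}
    (hN : N ∈ G) (hr : r ∈ G) (hQ : adjSwap N Q ∈ G) (hPQ : P ⊆ Q)
    (hd : Disjoint Q P') (hsep : Separated N (Q ∪ P'))
    (hrP : r '' P = P') (hfix : ∀ c, c ∉ P → c ∉ P' → r c = c) :
    adjSwap N P * adjSwap N P' ∈ G := by
  have hd' : ∀ c, c ∈ Q → c ∉ P' := fun c h1 h2 => Set.disjoint_left.1 hd h1 h2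
  have hout : ∀ c, c ∈ Q ∪ P' → r (N c) = N c := fun c hc =>
    hfix _ (fun h => hsep c hc (Or.inl (hPQ h))) (fun h => hsep c hc (Or.inr h))
  have hr' : ∀ c, c ∈ Q ∪ P' → (N * r * N⁻¹) c = c := fun c hc => by
    have : r (N.symm c) = N.symm c := hfix _
      (fun h => hsep _ (Or.inl (hPQ h)) (by simpa using hc))
      (fun h => hsep _ (Or.inr h) (by simpa using hc))
    change N (r (N.symm c)) = c
    rw [this, Equiv.apply_symm_apply]
  have hPsep : Separated N P := hsep.mono (hPQ.trans Set.subset_union_left)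
  have hP'sep : Separated N P' := hsep.mono Set.subset_union_right
  -- The factor `r` carries `P` to `P'`, and its conjugate carries `N P` to `N P'` in the same way.
  -- Separation keeps the two factors from interfering, so `M` moves whole pairs `{c, N c}`.
  set M := r * (N * r * N⁻¹) with hM
  have hMG : M ∈ G := mul_mem hr (mul_mem (mul_mem hN hr) (inv_mem hN))
  have hM1 : ∀ c ∈ Q ∪ P', M c = r c := fun c hc => by
    rw [hM, Equiv.Perm.mul_apply, hr' c hc]
  have hmaps : ∀ c ∈ P, r c ∈ P' := fun c hc => hrP ▸ Set.mem_image_of_mem _ hc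
  have hM2 : ∀ c ∈ Q, M (N c) = N (r c) := fun c hc => by
    have h1 : M (N c) = r (N (r c)) := by simp [hM]
    rw [h1]
    by_cases h : c ∈ P
    · exact hout _ (Or.inr (hmaps c h))
    · rw [hfix c h (hd' c hc)]
      exact hout c (Or.inl hc)
  have himg : M '' P = P' := by
    rw [← hrP]
    exact Set.image_congr fun c hc => hM1 c (Or.inl (hPQ hc))
  have e1 : M * adjSwap N P * M⁻¹ = adjSwap N P' := by
    rw [conj_adjSwap hPsep (by rwa [himg]) fun c hc => by
      rw [hM2 c (hPQ hc), hM1 c (Or.inl (hPQ hc))], himg]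
  have e2 : Commute M (adjSwap N (Q \ P)) := by
    have key : ∀ c ∈ Q \ P, r c = c := fun c hc => hfix c hc.2 (hd' c hc.1)
    refine commute_adjSwap_of_fix (fun c hc => ?_) fun c hc => ?_
    · rw [hM1 c (Or.inl hc.1), key c hc]
    · rw [hM2 c hc.1, key c hc]
  have e3 : adjSwap N Q = adjSwap N P * adjSwap N (Q \ P) := by
    rw [← adjSwap_union, Set.union_sdiff_cancel hPQ]
    · rw [Set.union_sdiff_cancel hPQ]
      exact hsep.mono Set.subset_union_left
    · exact Set.disjoint_sdiff_right
  have e4 : Commute (adjSwap N (Q \ P)) (adjSwap N P') := by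
    refine adjSwap_commute (hsep.mono ?_) (hd.mono_left Set.sdiff_subset)
    exact Set.union_subset_union_left _ Set.sdiff_subset
  -- `M` fixes the swap on `Q \ P`, which therefore occurs twice in the product and cancels.
  have : adjSwap N P * adjSwap N P' = adjSwap N Q * (M * adjSwap N Q * M⁻¹) := by
    have e5 : M * adjSwap N Q * M⁻¹ = adjSwap N P' * adjSwap N (Q \ P) := by
      rw [← e1, e3, mul_assoc M, mul_assoc (adjSwap N P), ← e2.inv_left.eq]
      simp only [mul_assoc]
    rw [e5, e3, mul_assoc, ← mul_assoc (adjSwap N (Q \ P)), e4.eq, mul_assoc, adjSwap_mul_self,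
      mul_one]
  rw [this]
  exact mul_mem hQ (mul_mem (mul_mem hMG hQ) (inv_mem hMG))

end AdjSwap

/-! ### Linear order on positions and states -/

section Moves

variable {n k : ℕ}

/-- The position of the head and the state, encoded in one integer. -/
def pos (c : Config n k) : ℤ := k * c.2.2 + (c.2.1 : ℕ)

theorem pos_ediv (c : Config n k) : pos c / k = c.2.2 := by
  have h : ((c.2.1 : ℕ) : ℤ) < k := by exact_mod_cast c.2.1.2
  have h0 : (0 : ℤ) < k := lt_of_le_of_lt (Int.natCast_nonneg _) h
  rw [pos, add_comm, Int.add_mul_ediv_left _ _ h0.ne', Int.ediv_eq_zero_of_lt (by positivity) h,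
    zero_add]

theorem pos_emod (c : Config n k) : pos c % k = (c.2.1 : ℕ) := by
  have h : ((c.2.1 : ℕ) : ℤ) < k := by exact_mod_cast c.2.1.2
  rw [pos, add_comm, Int.add_mul_emod_self_left, Int.emod_eq_of_lt (by positivity) h]

theorem ext_pos {c c' : Config n k} (h1 : c.1 = c'.1) (h2 : pos c = pos c') : c = c' := by
  refine Prod.ext h1 (Prod.ext (Fin.ext ?_) ?_)
  · have := pos_emod c
    rw [h2, pos_emod] at this
    exact_mod_cast this.symm
  · rw [← pos_ediv c, h2, pos_ediv]

variable [NeZero k]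

/-- Move by `d` steps in the order of `ℤ × Q`, without changing the tape. -/
def move (d : ℤ) (c : Config n k) : Config n k :=
  (c.1, ⟨(((c.2.1 : ℕ) + d) % k).toNat, by
    have := Int.emod_lt_of_pos (((c.2.1 : ℕ) : ℤ) + d) (b := k) (by exact_mod_cast NeZero.pos k)
    have := NeZero.pos k
    omega⟩, c.2.2 + ((c.2.1 : ℕ) + d) / k)

@[simp] theorem move_fst (d : ℤ) (c : Config n k) : (move d c).1 = c.1 := rfl

@[simp] theorem pos_move (d : ℤ) (c : Config n k) : pos (move d c) = pos c + d := by
  have h0 : (0 : ℤ) < k := by exact_mod_cast NeZero.pos k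
  have h1 := Int.emod_nonneg (((c.2.1 : ℕ) : ℤ) + d) h0.ne'
  have h2 := Int.emod_add_mul_ediv (((c.2.1 : ℕ) : ℤ) + d) k
  simp only [pos, move, Int.toNat_of_nonneg h1]
  linear_combination h2

theorem move_move (d e : ℤ) (c : Config n k) : move d (move e c) = move (e + d) c :=
  ext_pos rfl (by simp [add_assoc])

@[simp] theorem move_zero (c : Config n k) : move 0 c = c := ext_pos rfl (by simp)

theorem move_eq_of_tape {c c' : Config n k} (h : c'.1 = c.1) : c' = move (pos c' - pos c) c :=
  ext_pos h (by simp)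

theorem move_mul (i : ℤ) (c : Config n k) : move (k * i) c = (c.1, c.2.1, c.2.2 + i) :=
  ext_pos rfl (by rw [pos_move]; simp only [pos]; ring)

theorem move_injective_left {d e : ℤ} {c : Config n k} (h : move d c = move e c) : d = e := by
  have := congrArg pos h
  simpa using this

/-- The move by one step. -/
def step (n k : ℕ) [NeZero k] : Equiv.Perm (Config n k) where
  toFun := move 1
  invFun := move (-1)
  left_inv c := by simp [move_move]
  right_inv c := by simp [move_move]

theorem step_apply (c : Config n k) : step n k c = move 1 c := rfl

theorem step_symm_apply (c : Config n k) : (step n k).symm c = move (-1) c := rfl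

theorem step_pow_apply (i : ℕ) (c : Config n k) : (step n k ^ i) c = move i c := by
  induction i with
  | zero => simp
  | succ i ih =>
    rw [pow_succ', Equiv.Perm.mul_apply, ih, step_apply, move_move]
    push_cast
    rfl

theorem step_zpow_apply (i : ℤ) (c : Config n k) : (step n k ^ i) c = move i c := by
  obtain ⟨j, rfl | rfl⟩ := i.eq_nat_or_neg
  · rw [zpow_natCast, step_pow_apply]
  · rw [zpow_neg, zpow_natCast, Equiv.Perm.inv_eq_iff_eq, step_pow_apply, move_move]
    simp

end Moves

/-! ### Functions that depend on a bounded neighbourhood of the head -/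

section Local

variable {n k : ℕ}

/-- Two configurations have the same state and look the same up to distance `m` from the head. -/
def Agree (m : ℕ) (c c' : Config n k) : Prop :=
  c.2.1 = c'.2.1 ∧ ∀ i : ℤ, |i| ≤ m → c.1 (c.2.2 + i) = c'.1 (c'.2.2 + i)

theorem Agree.mono {m m' : ℕ} {c c' : Config n k} (h : Agree m' c c') (hm : m ≤ m') :
    Agree m c c' := ⟨h.1, fun i hi => h.2 i (hi.trans (by exact_mod_cast hm))⟩

/-- A move by `d` in the order of `ℤ × Q` displaces the head by at most `|d|` cells, so this much of
the radius is lost. -/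
theorem Agree.move [NeZero k] {m : ℕ} {c c' : Config n k} {d : ℤ}
    (h : Agree (m + d.natAbs) c c') : Agree m (move d c) (move d c') := by
  have hk : (0 : ℤ) < k := by exact_mod_cast NeZero.pos k
  have hd : |((c.2.1 : ℕ) + d) / (k : ℤ)| ≤ |d| := by
    have h1 : ((c.2.1 : ℕ) : ℤ) < k := by exact_mod_cast c.2.1.2
    rw [abs_le]
    constructor
    · rw [Int.le_ediv_iff_mul_le hk]
      have := neg_abs_le d
      nlinarith [abs_nonneg d]
    · rw [← Int.lt_add_one_iff, Int.ediv_lt_iff_lt_mul hk]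
      have := le_abs_self d
      nlinarith [abs_nonneg d]
  obtain ⟨h1, h2⟩ := h
  refine ⟨?_, fun i hi => ?_⟩
  · simp only [MovingHead.move, h1]
  · have := h2 (((c.2.1 : ℕ) + d) / (k : ℤ) + i) (by
      refine (abs_add_le _ _).trans ?_
      push_cast
      rw [add_comm]
      exact add_le_add hi hd)
    simp only [MovingHead.move]
    rw [← h1, add_assoc, add_assoc]
    exact this

/-- A function of configurations that depends only on the state and on the tape in a bounded
neighbourhood of the head. -/
def IsLocal {α : Type*} (f : Config n k → α) : Prop :=
  ∃ m : ℕ, ∀ c c', Agree m c c' → f c = f c'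

theorem isLocal_state : IsLocal (fun c : Config n k => c.2.1) := ⟨0, fun _ _ h => h.1⟩

theorem isLocal_const {α : Type*} (a : α) : IsLocal (fun _ : Config n k => a) :=
  ⟨0, fun _ _ _ => rfl⟩

theorem isLocal_tape (i : ℤ) : IsLocal (fun c : Config n k => c.1 (c.2.2 + i)) :=
  ⟨i.natAbs, fun _ _ h => h.2 i (by simp)⟩

variable {α β γ : Type*}

theorem IsLocal.map {f : Config n k → α} (hf : IsLocal f) (g : α → β) :
    IsLocal (fun c => g (f c)) := by
  obtain ⟨m, hm⟩ := hf
  exact ⟨m, fun c c' h => congrArg g (hm c c' h)⟩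

theorem IsLocal.map₂ {f : Config n k → α} {f' : Config n k → β} (hf : IsLocal f)
    (hf' : IsLocal f') (g : α → β → γ) : IsLocal (fun c => g (f c) (f' c)) := by
  obtain ⟨m, hm⟩ := hf
  obtain ⟨m', hm'⟩ := hf'
  refine ⟨max m m', fun c c' h => ?_⟩
  dsimp only
  rw [hm c c' (h.mono (le_max_left _ _)), hm' c c' (h.mono (le_max_right _ _))]

theorem IsLocal.ite {p : Config n k → Prop} [DecidablePred p] {f f' : Config n k → α}
    (hp : IsLocal p) (hf : IsLocal f) (hf' : IsLocal f') :
    IsLocal (fun c => if p c then f c else f' c) := by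
  classical
  convert hp.map₂ (hf.map₂ hf' Prod.mk) (fun P a => if P then a.1 else a.2) using 3

theorem IsLocal.comp_move [NeZero k] {f : Config n k → α} (hf : IsLocal f) (d : ℤ) :
    IsLocal (fun c => f (move d c)) := by
  obtain ⟨m, hm⟩ := hf
  exact ⟨m + d.natAbs, fun c c' h => hm _ _ h.move⟩

theorem IsLocal.forall_le {p : ℕ → Config n k → Prop} (hp : ∀ i, IsLocal (p i)) (l : ℕ) :
    IsLocal (fun c => ∀ i ≤ l, p i c) := by
  induction l with
  | zero => simpa using hp 0
  | succ l ih =>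
    have h := ih.map₂ (hp (l + 1)) And
    refine (congrArg IsLocal (funext fun c => propext ?_)).mp h
    refine ⟨fun h i hi => ?_, fun h => ⟨fun i hi => h i (by omega), h _ le_rfl⟩⟩
    rcases Nat.lt_or_eq_of_le hi with hi | rfl
    · exact h.1 i (by omega)
    · exact h.2

theorem LocalRule.exists_agree (f : LocalRule n k) :
    ∃ m : ℕ, ∀ c c', Agree m c c' → f.eval c = f.eval c' := by
  refine ⟨f.inSupp.sup Int.natAbs, fun c c' h => ?_⟩
  unfold LocalRule.eval
  rw [h.1]
  congr 2
  funext u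
  refine h.2 u ?_
  rw [Int.abs_eq_natAbs]
  exact_mod_cast Finset.le_sup (f := Int.natAbs) u.2

end Local

/-! ### Tape-preserving machines as products of swaps and powers of `step` -/

section Automata

variable {n k : ℕ}

/-- The displacement of `T` in the order of `ℤ × Q`. -/
def disp (T : Config n k → Config n k) (c : Config n k) : ℤ := pos (T c) - pos c

variable [NeZero k]

theorem apply_eq_move {T : Config n k → Config n k} (hT : ∀ c, (T c).1 = c.1) (c : Config n k) :
    T c = move (disp T c) c := move_eq_of_tape (hT c)

/-- A tape preserving bijection whose displacement attains its maximum on a long run is a power of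
`step`. -/
theorem disp_eq_of_run {T : Equiv.Perm (Config n k)} (hT : ∀ c, (T c).1 = c.1)
    (hloc : IsLocal (disp T)) {R D : ℤ} (hlow : ∀ c, -R ≤ disp T c) (hup : ∀ c, disp T c ≤ D)
    {l : ℕ} (hl : R + D ≤ l) {c₀ : Config n k} (hrun : ∀ i : ℕ, i ≤ l → disp T (move i c₀) = D)
    (c : Config n k) : disp T c = D := by
  have hright : ∀ c₁ : Config n k, (∀ i : ℕ, i ≤ l → disp T (move i c₁) = D) →
      ∀ i : ℕ, disp T (move i c₁) = D := by
    intro c₁ h1 i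
    induction i using Nat.strong_induction_on with
    | _ i ih =>
      rcases Nat.lt_or_ge l i with hi | hi
      · by_contra hne
        have h2 := hlow (move i c₁)
        have h3 := lt_of_le_of_ne (hup (move i c₁)) hne
        -- The image of position `i` is also the image of the earlier position `j`, whose
        -- displacement is `D`. That `j` is nonnegative is where `R + D ≤ l < i` enters.
        obtain ⟨j, hj⟩ := Int.eq_ofNat_of_zero_le
          (show 0 ≤ (i : ℤ) + disp T (move i c₁) - D by omega)
        have hji : j < i := by omega
        have h4 := ih j hji
        have h5 : T (move j c₁) = T (move i c₁) := by
          rw [apply_eq_move hT (move j c₁), apply_eq_move hT (move i c₁), h4, move_move, move_move]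
          congr 1
          omega
        have h6 := move_injective_left (T.injective h5)
        omega
      · exact h1 i hi
  obtain ⟨m₁, hm₁⟩ := IsLocal.forall_le
    (fun i => (hloc.comp_move i).map (fun d => d = D)) l
  obtain ⟨m, hm⟩ := hloc
  -- Splice the tapes: `c₀` with its long run on the left, a copy of `c` far to the right. Radius
  -- `m₁` preserves the run and radius `m` the displacement of `c`; the extra 1 keeps the two
  -- neighbourhoods disjoint and outweighs the difference of states.
  set V : ℤ := c₀.2.2 + m₁ + m + 1 with hV
  let z : Tape n := fun u => if u ≤ c₀.2.2 + m₁ then c₀.1 u else c.1 (u - V + c.2.2)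
  let c₁ : Config n k := (z, c₀.2.1, c₀.2.2)
  let c₂ : Config n k := (z, c.2.1, V)
  have h1 : ∀ i : ℕ, i ≤ l → disp T (move i c₁) = D := by
    refine (hm₁ c₀ c₁ ⟨rfl, fun i hi => ?_⟩).mp hrun
    have := (abs_le.1 hi).2
    change _ = z (c₀.2.2 + i)
    simp only [z]
    rw [if_pos (by omega)]
  have h2 : disp T c = disp T c₂ := by
    refine hm c c₂ ⟨rfl, fun i hi => ?_⟩
    have := (abs_le.1 hi).1
    change _ = z (V + i)
    simp only [z]
    rw [if_neg (by omega), show V + i - V + c.2.2 = c.2.2 + i by ring]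
  have h3 : 0 ≤ pos c₂ - pos c₁ := by
    have hq : ((c₀.2.1 : ℕ) : ℤ) < k := by exact_mod_cast c₀.2.1.2
    have hk : (0 : ℤ) < k := by exact_mod_cast NeZero.pos k
    simp only [pos, c₁, c₂, hV]
    have : (0 : ℤ) ≤ k * (m₁ + m) := by positivity
    have : (0 : ℤ) ≤ (c.2.1 : ℕ) := by positivity
    linarith
  obtain ⟨i, hi⟩ := Int.eq_ofNat_of_zero_le h3
  have h4 : c₂ = move i c₁ := by
    rw [← hi]
    exact move_eq_of_tape rfl
  rw [h2, h4]
  exact hright c₁ h1 i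

theorem adjSwap_step_fst (P : Set (Config n k)) (c : Config n k) :
    (adjSwap (step n k) P c).1 = c.1 := by
  by_cases h : Separated (step n k) P
  · classical
    rw [adjSwap_apply h]
    split_ifs <;> rfl
  · rw [adjSwap, dif_neg h]; rfl

open Classical in
theorem disp_adjSwap {P : Set (Config n k)} (h : Separated (step n k) P) (c : Config n k) :
    disp (adjSwap (step n k) P) c = if c ∈ P then 1 else if move (-1) c ∈ P then -1 else 0 := by
  rw [disp, adjSwap_apply h, step_apply, step_symm_apply]
  split_ifs <;> simp

theorem isLocal_disp_adjSwap {P : Set (Config n k)} (hP : IsLocal (· ∈ P)) :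
    IsLocal (disp (adjSwap (step n k) P)) := by
  classical
  by_cases h : Separated (step n k) P
  · rw [funext (disp_adjSwap h)]
    exact hP.ite (isLocal_const _) ((hP.comp_move (-1)).ite (isLocal_const _) (isLocal_const _))
  · have : disp (adjSwap (step n k) P) = fun _ => 0 := by
      funext c
      rw [adjSwap, dif_neg h]
      simp [disp]
    rw [this]
    exact isLocal_const _

/-- Tape preserving bijections of bounded local displacement are products of powers of `step` and
of adjacent swaps. -/
theorem mem_of_isLocal_disp [NeZero n] {G : Subgroup (Equiv.Perm (Config n k))}
    (hstep : step n k ∈ G)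
    (hswap : ∀ P : Set (Config n k), IsLocal (· ∈ P) → Separated (step n k) P →
      adjSwap (step n k) P ∈ G)
    {T : Equiv.Perm (Config n k)} (hT : ∀ c, (T c).1 = c.1) (hloc : IsLocal (disp T))
    {R : ℤ} (hR : ∀ c, |disp T c| ≤ R) : T ∈ G := by
  -- Outer induction on the height `d` of the range of displacements above `-R`; inner induction on
  -- a bound `l` for the runs of maximal displacement.
  have main : ∀ (d : ℕ) (T : Equiv.Perm (Config n k)), (∀ c, (T c).1 = c.1) →
      IsLocal (disp T) → (∀ c, -R ≤ disp T c) → (∀ c, disp T c < -R + d) → T ∈ G := by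
    intro d
    induction d with
    | zero =>
      intro T _ _ h1 h2
      have c : Config n k := (fun _ => 0, 0, 0)
      have := h1 c
      have := h2 c
      simp only [Nat.cast_zero] at this
      omega
    | succ d ihd =>
      have inner : ∀ (l : ℕ) (T : Equiv.Perm (Config n k)), (∀ c, (T c).1 = c.1) →
          IsLocal (disp T) → (∀ c, -R ≤ disp T c) → (∀ c, disp T c ≤ -R + d) →
          (∀ c, ∃ i : ℕ, i ≤ l ∧ disp T (move i c) ≠ -R + d) → T ∈ G := by
        intro l
        induction l with
        | zero =>
          intro T hT hloc hlow hup hrun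
          refine ihd T hT hloc hlow fun c => lt_of_le_of_ne (hup c) ?_
          obtain ⟨i, hi, h⟩ := hrun c
          obtain rfl : i = 0 := by omega
          simpa using h
        | succ l ihl =>
          intro T hT hloc hlow hup hrun
          classical
          -- The right ends of the maximal runs. Swapping each with its successor shortens every run
          -- by one.
          let P : Set (Config n k) :=
            {c | disp T c = -R + d ∧ disp T (move 1 c) ≠ -R + d}
          have hPloc : IsLocal (· ∈ P) :=
            (hloc.map (· = -R + d)).map₂ ((hloc.comp_move 1).map (· ≠ -R + d)) And
          have hPsep : Separated (step n k) P := fun c hc hc' => hc.2 hc'.1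
          have hval : ∀ c, disp (T * adjSwap (step n k) P) c =
              if c ∈ P then disp T (move 1 c) + 1 else
                if move (-1) c ∈ P then disp T (move (-1) c) - 1 else disp T c := by
            intro c
            rw [disp, Equiv.Perm.mul_apply, adjSwap_apply hPsep, step_apply, step_symm_apply]
            split_ifs
            · simp only [disp, pos_move]; ring
            · simp only [disp, pos_move]; ring
            · rfl
          -- Displacement one below the maximum would send `move 1 c` to the image of `c`. This gap
          -- of two ensures that the swap creates no new maximum.
          have hnext : ∀ c ∈ P, disp T (move 1 c) + 2 ≤ -R + d := by
            intro c hc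
            have h1 := lt_of_le_of_ne (hup _) hc.2
            have h2 : disp T (move 1 c) ≠ -R + d - 1 := by
              intro h
              have h3 : T (move 1 c) = T c := by
                rw [apply_eq_move hT (move 1 c), apply_eq_move hT c, h, hc.1, move_move]
                congr 1
                ring
              have h4 := congrArg pos (T.injective h3)
              simp at h4
            omega
          have hmem : T * adjSwap (step n k) P ∈ G := by
            refine ihl _ (fun c => ?_) ?_ (fun c => ?_) (fun c => ?_) (fun c => ?_)
            · rw [Equiv.Perm.mul_apply, hT, adjSwap_step_fst]
            · rw [funext hval]
              exact hPloc.ite ((hloc.comp_move 1).map (· + 1))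
                ((hPloc.comp_move (-1)).ite ((hloc.comp_move (-1)).map (· - 1)) hloc)
            · rw [hval]
              split_ifs with h1 h2
              · have := hlow (move 1 c)
                omega
              · have h3 := hnext _ h2
                have h4 := hlow (move 1 (move (-1) c))
                have h5 := h2.1
                omega
              · exact hlow c
            · rw [hval]
              split_ifs with h1 h2
              · have := hnext _ h1
                omega
              · have := hup (move (-1) c)
                omega
              · exact hup c
            · by_contra! hcon
              have hD : ∀ c, disp (T * adjSwap (step n k) P) c = -R + d →
                  disp T c = -R + d ∧ disp T (move 1 c) = -R + d := by
                intro c hc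
                rw [hval] at hc
                split_ifs at hc with h1 h2
                · have := hnext _ h1
                  omega
                · have := h2.1
                  omega
                · exact ⟨hc, by_contra fun h => h1 ⟨hc, h⟩⟩
              obtain ⟨i, hi, h⟩ := hrun c
              rcases Nat.lt_or_ge l i with hi' | hi'
              · obtain rfl : i = l + 1 := by omega
                have := (hD _ (hcon l le_rfl)).2
                rw [move_move] at this
                exact h (by push_cast; exact this)
              · exact h (hD _ (hcon i hi')).1
          have h1 := mul_mem hmem (hswap P hPloc hPsep)
          rwa [mul_assoc, adjSwap_mul_self, mul_one] at h1
      intro T hT hloc hlow hup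
      have hup' : ∀ c, disp T c ≤ -R + d := fun c => by
        have := hup c
        push_cast at this
        omega
      -- For the maximum `D = -R + d` the threshold `R + D` of `disp_eq_of_run` is exactly `d`.
      by_cases hrun : ∃ c, ∀ i : ℕ, i ≤ d → disp T (move i c) = -R + d
      · obtain ⟨c₀, hc₀⟩ := hrun
        have h1 := disp_eq_of_run hT hloc hlow hup' (by omega) hc₀
        have : T = step n k ^ (-R + d : ℤ) := by
          ext1 c
          rw [step_zpow_apply, apply_eq_move hT, h1]
        rw [this]
        exact zpow_mem hstep _
      · push Not at hrun
        exact inner d T hT hloc hlow hup' fun c => by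
          obtain ⟨i, hi, h⟩ := hrun c
          exact ⟨i, hi, h⟩
  refine main (2 * R + 1).toNat T hT hloc (fun c => (abs_le.1 (hR c)).1) fun c => ?_
  have := abs_le.1 (hR c)
  omega

theorem isTuringMachine_of_isLocal_disp {T : Config n k → Config n k} (hT : ∀ c, (T c).1 = c.1)
    (hloc : IsLocal (disp T)) : IsTuringMachine T := by
  obtain ⟨m, hm⟩ := hloc
  refine isTuringMachine_of_window (Finset.Icc (-m : ℤ) m) (fun c u _ => by rw [hT]) ?_
  intro c c' h hq
  have hd := hm c c' ⟨hq, fun i hi => h i (Finset.mem_Icc.2 (abs_le.1 hi))⟩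
  refine ⟨fun w hw => by rw [hT, hT]; exact h w hw, ?_, ?_⟩
  · rw [apply_eq_move hT c, apply_eq_move hT c', hd]
    simp only [move, hq]
  · rw [apply_eq_move hT c, apply_eq_move hT c', hd]
    simp only [move, hq]
    ring

theorem mem_RFA_of_isLocal_disp {T : Equiv.Perm (Config n k)} (hT : ∀ c, (T c).1 = c.1)
    (hloc : IsLocal (disp T)) (hloc' : IsLocal (disp T.symm)) : T ∈ RFA n k :=
  ⟨⟨isTuringMachine_of_isLocal_disp hT hloc, isTuringMachine_of_isLocal_disp
    (fun c => by rw [← hT, Equiv.apply_symm_apply]) hloc'⟩, hT⟩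

theorem step_mem_RFA : step n k ∈ RFA n k := by
  refine mem_RFA_of_isLocal_disp (fun _ => rfl) ?_ ?_
  · convert isLocal_const (n := n) (k := k) (1 : ℤ) using 1
    funext c
    simp [disp, step_apply]
  · convert isLocal_const (n := n) (k := k) (-1 : ℤ) using 1
    funext c
    simp [disp, step_symm_apply]

theorem adjSwap_step_mem_RFA {P : Set (Config n k)} (hP : IsLocal (· ∈ P)) :
    adjSwap (step n k) P ∈ RFA n k := by
  refine mem_RFA_of_isLocal_disp (adjSwap_step_fst P) (isLocal_disp_adjSwap hP) ?_
  rw [show (adjSwap (step n k) P).symm = adjSwap (step n k) P from adjSwap_inv _ _]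
  exact isLocal_disp_adjSwap hP

theorem RFA_le [NeZero n] {G : Subgroup (Equiv.Perm (Config n k))} (hstep : step n k ∈ G)
    (hswap : ∀ P : Set (Config n k), IsLocal (· ∈ P) → Separated (step n k) P →
      adjSwap (step n k) P ∈ G) : RFA n k ≤ G := by
  rintro T ⟨⟨⟨f, hf⟩, -⟩, hT⟩
  have hdisp : disp T = fun c => k * (f.eval c).2.2 + ((f.eval c).2.1 : ℕ) - (c.2.1 : ℕ) := by
    funext c
    rw [disp, hf]
    simp only [pos, LocalRule.toMap]
    ring
  have hloc : IsLocal (disp T) := by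
    rw [hdisp]
    exact IsLocal.map₂ (f.exists_agree) isLocal_state
      (fun a (b : Fin k) => k * a.2.2 + ((a.2.1 : ℕ) : ℤ) - (b : ℕ))
  obtain ⟨M, hM⟩ := (Set.finite_range fun a => |(f.rule a).2.2|).bddAbove
  refine mem_of_isLocal_disp hstep hswap hT hloc (R := k * M + k) fun c => ?_
  have h1 : |(f.eval c).2.2| ≤ M := hM ⟨_, rfl⟩
  have h2 : (((f.eval c).2.1 : ℕ) : ℤ) < k := by exact_mod_cast (f.eval c).2.1.2
  have h3 : ((c.2.1 : ℕ) : ℤ) < k := by exact_mod_cast c.2.1.2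
  have h4 : |(k : ℤ) * (f.eval c).2.2| ≤ k * M := by
    rw [abs_mul, Nat.abs_cast]
    exact mul_le_mul_of_nonneg_left h1 (by positivity)
  rw [hdisp]
  rw [abs_le] at h4 ⊢
  constructor <;> dsimp only <;> omega

end Automata

/-! ### Even permutations of a product from overlapping factors -/

section Alternating

open Equiv.Perm
open scoped commutatorElement

theorem exists_mem_alternatingGroup_apply_eq {α : Type*} [Fintype α] [DecidableEq α]
    (hα : 5 ≤ Fintype.card α) {f g : Fin 3 → α} (hf : f.Injective) (hg : g.Injective) :
    ∃ σ ∈ alternatingGroup α, ∀ i, σ (f i) = g i := by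
  have h1 := alternatingGroup.isMultiplyPretransitive α
  have h2 : MulAction.IsMultiplyPretransitive (alternatingGroup α) α 3 :=
    MulAction.isMultiplyPretransitive_of_le (n := Nat.card α - 2)
      (by rw [Nat.card_eq_fintype_card]; omega) (by omega)
  obtain ⟨σ, hσ⟩ := h2.exists_smul_eq ⟨f, hf⟩ ⟨g, hg⟩
  exact ⟨σ, σ.2, fun i => congrArg (fun e : Fin 3 ↪ α => e i) hσ⟩

/-- Three distinct points of a product may have coinciding projections; this makes 3-transitivity
applicable to the projections all the same. -/
theorem exists_injective_range {α : Type*} [Fintype α] (hα : 3 ≤ Fintype.card α)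
    (p : Fin 3 → α) : ∃ f : Fin 3 → α, f.Injective ∧ ∀ i, ∃ j, f j = p i := by
  classical
  obtain ⟨s, hs, hc⟩ := Finset.exists_superset_card_eq (s := Finset.univ.image p) (n := 3)
    Finset.card_image_le hα
  let e := (Finset.equivFinOfCardEq hc).symm
  refine ⟨fun i => e i, Subtype.val_injective.comp e.injective, fun i => ?_⟩
  refine ⟨e.symm ⟨p i, hs (Finset.mem_image_of_mem p (Finset.mem_univ i))⟩, ?_⟩
  simp

variable {X Y Z : Type*}

/-- Apply a permutation to the first two coordinates. -/
def permFst (Z : Type*) (σ : Equiv.Perm (X × Y)) : Equiv.Perm (X × Y × Z) :=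
  (Equiv.prodAssoc X Y Z).permCongr (Equiv.prodCongr σ (Equiv.refl Z))

/-- Apply a permutation to the last two coordinates. -/
def permSnd (X : Type*) (σ : Equiv.Perm (Y × Z)) : Equiv.Perm (X × Y × Z) :=
  Equiv.prodCongr (Equiv.refl X) σ

theorem permFst_apply (σ : Equiv.Perm (X × Y)) (x : X) (y : Y) (z : Z) :
    permFst Z σ (x, y, z) = ((σ (x, y)).1, (σ (x, y)).2, z) := rfl

theorem permSnd_apply (σ : Equiv.Perm (Y × Z)) (x : X) (y : Y) (z : Z) :
    permSnd X σ (x, y, z) = (x, σ (y, z)) := rfl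

open Classical in
/-- Apply a permutation to the middle coordinate if the other two satisfy a condition. -/
noncomputable def ctrl (p : X → Z → Prop) : Equiv.Perm Y →* Equiv.Perm (X × Y × Z) :=
  MonoidHom.mk' (fun σ =>
    { toFun := fun a => if p a.1 a.2.2 then (a.1, σ a.2.1, a.2.2) else a
      invFun := fun a => if p a.1 a.2.2 then (a.1, σ.symm a.2.1, a.2.2) else a
      left_inv := fun a => by by_cases h : p a.1 a.2.2 <;> simp [h]
      right_inv := fun a => by by_cases h : p a.1 a.2.2 <;> simp [h] })
    (fun σ τ => by
      ext1 a
      by_cases h : p a.1 a.2.2 <;> simp [h])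

open Classical in
theorem ctrl_apply (p : X → Z → Prop) (σ : Equiv.Perm Y) (a : X × Y × Z) :
    ctrl p σ a = if p a.1 a.2.2 then (a.1, σ a.2.1, a.2.2) else a := rfl

/-- Where one of the conditions fails, one factor acts trivially and the other cancels with its
inverse. -/
theorem commutator_ctrl (p q : X → Z → Prop) (σ τ : Equiv.Perm Y) :
    ⁅ctrl p σ, ctrl q τ⁆ = ctrl (fun x z => p x z ∧ q x z) ⁅σ, τ⁆ := by
  ext1 a
  simp only [commutatorElement_def, ← map_inv, Equiv.Perm.mul_apply, ctrl_apply]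
  by_cases hp : p a.1 a.2.2 <;> by_cases hq : q a.1 a.2.2 <;> simp [hp, hq]

theorem ctrl_swap [DecidableEq X] [DecidableEq Y] [DecidableEq Z] (x : X) (z : Z) (y y' : Y) :
    ctrl (fun a b => a = x ∧ b = z) (Equiv.swap y y') = Equiv.swap (x, y, z) (x, y', z) := by
  ext1 ⟨a, b, c⟩
  rw [ctrl_apply]
  simp only [Equiv.swap_apply_def, Prod.mk.injEq]
  split_ifs <;> grind

variable [Fintype X] [Fintype Y] [Fintype Z] [DecidableEq X] [DecidableEq Y] [DecidableEq Z]

/-- Permutations of overlapping pairs of coordinates generate all even permutations. -/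
theorem alternatingGroup_le_of_permFst_of_permSnd (hY : 5 ≤ Fintype.card Y) [Nonempty X]
    [Nonempty Z] (H : Subgroup (Equiv.Perm (X × Y × Z)))
    (h1 : ∀ σ ∈ alternatingGroup (X × Y), permFst Z σ ∈ H)
    (h2 : ∀ σ ∈ alternatingGroup (Y × Z), permSnd X σ ∈ H) :
    alternatingGroup (X × Y × Z) ≤ H := by
  obtain ⟨x₀⟩ := ‹Nonempty X›
  obtain ⟨z₀⟩ := ‹Nonempty Z›
  have hX1 : 1 ≤ Fintype.card X := Fintype.card_pos_iff.2 ⟨x₀⟩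
  have hZ1 : 1 ≤ Fintype.card Z := Fintype.card_pos_iff.2 ⟨z₀⟩
  have hXY : 5 ≤ Fintype.card (X × Y) := by rw [Fintype.card_prod]; nlinarith
  have hYZ : 5 ≤ Fintype.card (Y × Z) := by rw [Fintype.card_prod]; nlinarith
  have hc1 : ∀ σ ∈ alternatingGroup Y, ctrl (fun a _ => a = x₀) σ ∈ H := by
    intro σ hσ
    have h := h1 (prodExtendRight x₀ σ) (by
      rw [mem_alternatingGroup, sign_prodExtendRight]
      exact hσ)
    convert h using 1
    ext1 ⟨a, b, c⟩
    rw [ctrl_apply, permFst_apply]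
    by_cases ha : a = x₀
    · subst ha
      simp
    · simp [ha, prodExtendRight_apply_ne]
  have hc2 : ∀ σ ∈ alternatingGroup Y, ctrl (fun _ b => b = z₀) σ ∈ H := by
    intro σ hσ
    have h := h2 ((Equiv.prodComm Z Y).permCongr (prodExtendRight z₀ σ)) (by
      rw [mem_alternatingGroup, sign_permCongr, sign_prodExtendRight]
      exact hσ)
    convert h using 1
    ext1 ⟨a, b, c⟩
    rw [ctrl_apply, permSnd_apply]
    by_cases hc : c = z₀
    · subst hc
      simp
    · simp [hc, prodExtendRight_apply_ne]
  -- Since the alternating group on at least five points is perfect, commutators give every even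
  -- permutation under both controls at once.
  have hc : ∀ σ ∈ alternatingGroup Y, ctrl (fun a b => a = x₀ ∧ b = z₀) σ ∈ H := by
    have : ⁅alternatingGroup Y, alternatingGroup Y⁆ ≤
        H.comap (ctrl (fun a b => a = x₀ ∧ b = z₀)) := by
      rw [Subgroup.commutator_le]
      intro σ hσ τ hτ
      rw [Subgroup.mem_comap, ← commutator_ctrl (fun a _ => a = x₀) (fun _ b => b = z₀)]
      have h3 := hc1 σ hσ
      have h4 := hc2 τ hτ
      exact mul_mem (mul_mem (mul_mem h3 h4) (inv_mem h3)) (inv_mem h4)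
    rw [commutator_alternatingGroup_eq_self
      (by rwa [Nat.card_eq_fintype_card])] at this
    exact this
  obtain ⟨y, hy⟩ : ∃ y : Fin 3 → Y, y.Injective := by
    obtain ⟨e⟩ := Function.Embedding.nonempty_of_card_le (α := Fin 3) (β := Y)
      (by rw [Fintype.card_fin]; omega)
    exact ⟨e, e.injective⟩
  let P : Fin 3 → X × Y × Z := fun i => (x₀, y i, z₀)
  -- First normalise the `X` coordinates by a permutation of `X × Y`. The three points stay
  -- distinct, so their `Y × Z` parts are distinct and can be sent to their targets.
  have htrans : ∀ p : Fin 3 → X × Y × Z, p.Injective → ∃ h ∈ H, ∀ i, h (p i) = P i := by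
    intro p hp
    obtain ⟨f, hf, hfp⟩ := exists_injective_range (by omega) fun i => ((p i).1, (p i).2.1)
    choose j hj using hfp
    obtain ⟨σ, hσ, hσf⟩ := exists_mem_alternatingGroup_apply_eq hXY hf
      (g := fun i => (x₀, y i)) (fun a b h => hy (Prod.ext_iff.1 h).2)
    have e1 : ∀ i, permFst Z σ (p i) = (x₀, y (j i), (p i).2.2) := fun i => by
      have : p i = ((p i).1, (p i).2.1, (p i).2.2) := rfl
      rw [this, permFst_apply, ← hj, hσf]
    obtain ⟨τ, hτ, hτf⟩ := exists_mem_alternatingGroup_apply_eq hYZ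
      (f := fun i => (y (j i), (p i).2.2)) (g := fun i => (y i, z₀)) (fun a b h => by
        obtain ⟨h3, h4⟩ := Prod.ext_iff.1 h
        refine hp ((permFst Z σ).injective ?_)
        rw [e1, e1]
        dsimp only at h3 h4
        rw [h3, h4]) (fun a b h => hy (Prod.ext_iff.1 h).1)
    refine ⟨permSnd X τ * permFst Z σ, mul_mem (h2 τ hτ) (h1 σ hσ), fun i => ?_⟩
    rw [Equiv.Perm.mul_apply, e1, permSnd_apply, hτf]
  have hP : P.Injective := fun a b h => hy (Prod.ext_iff.1 (Prod.ext_iff.1 h).2).1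
  have hthree : IsThreeCycle (Equiv.swap (P 0) (P 1) * Equiv.swap (P 0) (P 2)) :=
    isThreeCycle_swap_mul_swap_same (hP.ne (by decide)) (hP.ne (by decide)) (hP.ne (by decide))
  have hmem : Equiv.swap (P 0) (P 1) * Equiv.swap (P 0) (P 2) ∈ H := by
    simp only [P]
    rw [← ctrl_swap, ← ctrl_swap, ← map_mul]
    exact hc _ (mul_mem_alternatingGroup_of_isSwap (swap_isSwap_iff.2 (hy.ne (by decide)))
      (swap_isSwap_iff.2 (hy.ne (by decide))))
  rw [← closure_three_cycles_eq_alternating, Subgroup.closure_le]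
  intro σ hσ
  obtain ⟨g, hg⟩ := isConj_iff.1
    (isConj_iff_cycleType_eq.2 (hthree.cycleType.trans (IsThreeCycle.cycleType hσ).symm))
  -- A conjugate of the 3-cycle depends only on the images of its three points, so `g` can be
  -- replaced by an element of `H`.
  obtain ⟨h, hh, hhP⟩ := htrans (fun i => g (P i)) (g.injective.comp hP)
  have hgP : ∀ i, g (P i) = h⁻¹ (P i) := fun i => by
    rw [eq_comm, Equiv.Perm.inv_eq_iff_eq]
    exact (hhP i).symm
  have : σ = h⁻¹ * (Equiv.swap (P 0) (P 1) * Equiv.swap (P 0) (P 2)) * (h⁻¹)⁻¹ := by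
    rw [← hg, ← conj_mul, ← conj_mul]
    simp only [← Equiv.swap_apply_apply, hgP]
  rw [this]
  exact mul_mem (mul_mem (inv_mem hh) hmem) (inv_mem (inv_mem hh))

end Alternating

/-! ### Permutations of the patterns in a window -/

section Windows

variable {n k : ℕ}

/-- The contents of a window of `l` cells, together with a state. -/
abbrev Pattern (n k l : ℕ) : Type := (Fin l → Fin n) × Fin k

/-- The pattern seen in the window of length `l` that starts `a` cells to the right of the head. -/
def readPat (a : ℤ) (l : ℕ) (c : Config n k) : Pattern n k l :=
  (fun i => c.1 (c.2.2 + a + (i : ℕ)), c.2.1)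

/-- Overwrite the window of length `l` that starts `a` cells to the right of the head. -/
def writePat (a : ℤ) (l : ℕ) (c : Config n k) (p : Pattern n k l) : Config n k :=
  (fun u => if h : 0 ≤ u - (c.2.2 + a) ∧ u - (c.2.2 + a) < l then
      p.1 ⟨(u - (c.2.2 + a)).toNat, by omega⟩ else c.1 u, p.2, c.2.2)

theorem eq_writePat {a : ℤ} {l : ℕ} {c c' : Config n k} {p : Pattern n k l}
    (h1 : c'.2.2 = c.2.2) (h2 : readPat a l c' = p)
    (h3 : ∀ u, ¬ (0 ≤ u - (c.2.2 + a) ∧ u - (c.2.2 + a) < l) → c'.1 u = c.1 u) :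
    c' = writePat a l c p := by
  subst h2
  refine Prod.ext ?_ (Prod.ext rfl h1)
  funext u
  by_cases h : 0 ≤ u - (c.2.2 + a) ∧ u - (c.2.2 + a) < l
  · simp only [writePat, dif_pos h, readPat, h1, Int.toNat_of_nonneg h.1]
    exact congrArg c'.1 (by ring)
  · simp only [writePat, dif_neg h]
    exact h3 u h

theorem writePat_fst_of_not {a : ℤ} {l : ℕ} {c : Config n k} {p : Pattern n k l} {u : ℤ}
    (h : ¬ (0 ≤ u - (c.2.2 + a) ∧ u - (c.2.2 + a) < l)) : (writePat a l c p).1 u = c.1 u := by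
  simp only [writePat, dif_neg h]

theorem writePat_fst {a : ℤ} {l : ℕ} (c : Config n k) (p : Pattern n k l) (i : Fin l) :
    (writePat a l c p).1 (c.2.2 + a + (i : ℕ)) = p.1 i := by
  have h : 0 ≤ c.2.2 + a + (i : ℕ) - (c.2.2 + a) ∧ c.2.2 + a + (i : ℕ) - (c.2.2 + a) < l := by
    have := i.2
    omega
  simp only [writePat, dif_pos h]
  exact congrArg p.1 (Fin.ext (by simp))

@[simp] theorem writePat_head (a : ℤ) (l : ℕ) (c : Config n k) (p : Pattern n k l) :
    (writePat a l c p).2.2 = c.2.2 := rfl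

@[simp] theorem readPat_writePat (a : ℤ) (l : ℕ) (c : Config n k) (p : Pattern n k l) :
    readPat a l (writePat a l c p) = p :=
  Prod.ext (funext fun i => writePat_fst c p i) rfl

@[simp] theorem writePat_readPat (a : ℤ) (l : ℕ) (c : Config n k) :
    writePat a l c (readPat a l c) = c := (eq_writePat rfl rfl fun _ _ => rfl).symm

@[simp] theorem writePat_writePat (a : ℤ) (l : ℕ) (c : Config n k) (p q : Pattern n k l) :
    writePat a l (writePat a l c p) q = writePat a l c q :=
  eq_writePat rfl (readPat_writePat _ _ _ _) fun _ h =>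
    (writePat_fst_of_not (c := writePat a l c p) h).trans (writePat_fst_of_not h)

/-- The action of the permutations of the patterns in a window on configurations. -/
def winPerm (a : ℤ) (l : ℕ) : Equiv.Perm (Pattern n k l) →* Equiv.Perm (Config n k) :=
  MonoidHom.mk' (fun σ =>
    { toFun := fun c => writePat a l c (σ (readPat a l c))
      invFun := fun c => writePat a l c (σ.symm (readPat a l c))
      left_inv := fun c => by simp
      right_inv := fun c => by simp })
    (fun σ τ => by ext1 c; simp)

theorem winPerm_apply (a : ℤ) (l : ℕ) (σ : Equiv.Perm (Pattern n k l)) (c : Config n k) :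
    winPerm a l σ c = writePat a l c (σ (readPat a l c)) := rfl

/-- The permutation is read off on a blank background; injectivity of `T` gives bijectivity because
there are finitely many patterns. -/
theorem exists_winPerm_eq [NeZero n] [NeZero k] {a : ℤ} {l : ℕ} {T : Equiv.Perm (Config n k)}
    (h1 : ∀ c, (T c).2.2 = c.2.2)
    (h2 : ∀ c u, ¬ (0 ≤ u - (c.2.2 + a) ∧ u - (c.2.2 + a) < l) → (T c).1 u = c.1 u)
    (h3 : ∀ c c', readPat a l c = readPat a l c' → readPat a l (T c) = readPat a l (T c')) :
    ∃ σ, T = winPerm a l σ := by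
  let c₀ : Config n k := (fun _ => 0, 0, 0)
  have hT : ∀ c, T c = writePat a l c (readPat a l (T c)) := fun c => eq_writePat (h1 c) rfl (h2 c)
  let f : Pattern n k l → Pattern n k l := fun p => readPat a l (T (writePat a l c₀ p))
  have hf : f.Injective := by
    intro p q h
    have h4 : T (writePat a l c₀ p) = T (writePat a l c₀ q) := by
      rw [hT (writePat a l c₀ p), hT (writePat a l c₀ q), writePat_writePat, writePat_writePat]
      exact congrArg _ h
    have h5 := congrArg (readPat a l) (T.injective h4)
    simpa using h5
  refine ⟨Equiv.ofBijective f (Finite.injective_iff_bijective.1 hf), ?_⟩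
  ext1 c
  rw [winPerm_apply, hT c]
  congr 1
  exact h3 _ _ (by simp)

theorem readPat_eq_iff_agree {m : ℕ} {c c' : Config n k} :
    readPat (-m) (2 * m + 1) c = readPat (-m) (2 * m + 1) c' ↔ Agree m c c' := by
  constructor
  · intro h
    refine ⟨(Prod.ext_iff.1 h).2, fun i hi => ?_⟩
    rw [abs_le] at hi
    have h1 := congrFun (Prod.ext_iff.1 h).1 ⟨(i + m).toNat, by omega⟩
    have h2 : ((i + m).toNat : ℤ) = i + m := Int.toNat_of_nonneg (by omega)
    simp only [readPat, h2] at h1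
    convert h1 using 2 <;> ring
  · rintro ⟨h1, h2⟩
    refine Prod.ext (funext fun i => ?_) h1
    have h3 := h2 (-m + (i : ℕ)) (by
      have := i.2
      rw [abs_le]
      omega)
    simpa only [readPat, add_assoc] using h3

/-- A local permutation acts on all large windows. -/
theorem exists_winPerm_eq_of_mem_LP [NeZero n] [NeZero k] {T : Equiv.Perm (Config n k)}
    (hT : T ∈ LP n k) :
    ∃ m₀ : ℕ, ∀ m, m₀ ≤ m → ∃ σ, T = winPerm (-m : ℤ) (2 * m + 1) σ := by
  obtain ⟨⟨⟨f, hf⟩, -⟩, hhead⟩ := hT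
  obtain ⟨m, hm⟩ := f.exists_agree
  refine ⟨max m (f.outSupp.sup Int.natAbs), fun m' hm' => ?_⟩
  refine exists_winPerm_eq hhead (fun c u hu => ?_) fun c c' h => ?_
  · rw [hf]
    refine dif_neg fun h => hu ?_
    have : (u - c.2.2).natAbs ≤ m' :=
      (Finset.le_sup (f := Int.natAbs) h).trans ((le_max_right _ _).trans hm')
    omega
  · rw [readPat_eq_iff_agree] at h ⊢
    have he := hm c c' (h.mono ((le_max_left _ _).trans hm'))
    rw [hf]
    refine ⟨congrArg (fun a => a.2.1) he, fun i hi => ?_⟩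
    have e1 : (f.toMap c).2.2 = c.2.2 := by rw [← hf]; exact hhead c
    have e2 : (f.toMap c').2.2 = c'.2.2 := by rw [← hf]; exact hhead c'
    rw [e1, e2]
    simp only [LocalRule.toMap, add_sub_cancel_left, he, h.2 i hi]

theorem exists_winPerm_eq_of_subsingleton [NeZero k] (hn : n = 1) {T : Equiv.Perm (Config n k)}
    (hT : T ∈ LP n k) (a : ℤ) (l : ℕ) : ∃ σ, T = winPerm a l σ := by
  subst hn
  obtain ⟨⟨⟨f, hf⟩, -⟩, hhead⟩ := hT
  obtain ⟨m, hm⟩ := f.exists_agree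
  refine exists_winPerm_eq hhead (fun c u hu => Subsingleton.elim _ _) fun c c' h => ?_
  refine Prod.ext (Subsingleton.elim _ _) ?_
  rw [hf]
  exact congrArg (fun a => a.2.1)
    (hm c c' ⟨(Prod.ext_iff.1 h).2, fun _ _ => Subsingleton.elim _ _⟩)

theorem winPerm_mem_LP (a : ℤ) (l : ℕ) (σ : Equiv.Perm (Pattern n k l)) :
    winPerm a l σ ∈ LP n k := by
  have key : ∀ τ : Equiv.Perm (Pattern n k l),
      IsTuringMachine (winPerm a l τ : Config n k → Config n k) := by
    intro τ
    refine isTuringMachine_of_window (Finset.Ico a (a + l)) (fun c u hu => ?_) ?_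
    · refine writePat_fst_of_not fun h => hu ?_
      rw [Finset.mem_Ico]
      omega
    · intro c c' h hq
      have hr : readPat a l c = readPat a l c' := by
        refine Prod.ext (funext fun i => ?_) hq
        have := h (a + (i : ℕ)) (by
          rw [Finset.mem_Ico]
          have := i.2
          omega)
        simpa only [readPat, add_assoc] using this
      simp only [winPerm_apply, hr]
      refine ⟨fun w hw => ?_, rfl, by simp [writePat]⟩
      obtain ⟨i, hi⟩ := Int.eq_ofNat_of_zero_le (sub_nonneg.2 (Finset.mem_Ico.1 hw).1)
      have hil : i < l := by
        have := (Finset.mem_Ico.1 hw).2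
        omega
      have hw' : w = a + ((⟨i, hil⟩ : Fin l) : ℕ) := by
        change w = a + (i : ℤ)
        omega
      rw [hw', ← add_assoc, ← add_assoc, writePat_fst, writePat_fst]
  exact ⟨⟨key σ, by
    have := key σ⁻¹
    rw [map_inv] at this
    exact this⟩, fun _ => rfl⟩

theorem winPerm_eq_conj [NeZero k] (a : ℤ) (l : ℕ) (σ : Equiv.Perm (Pattern n k l)) :
    winPerm a l σ = step n k ^ (-((k : ℤ) * a)) * winPerm 0 l σ * step n k ^ ((k : ℤ) * a) := by
  ext1 c
  rw [Equiv.Perm.mul_apply, Equiv.Perm.mul_apply, step_zpow_apply, step_zpow_apply,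
    ← mul_neg, move_mul, move_mul, winPerm_apply, winPerm_apply]
  have hr : readPat 0 l ((c.1, c.2.1, c.2.2 + a) : Config n k) = readPat a l c := by
    simp [readPat]
  rw [hr]
  simp [writePat]

/-- Split off the last cell of a window. -/
def snocSplit (n k l : ℕ) : Pattern n k (l + 1) ≃ Pattern n k l × Fin n where
  toFun p := ((fun i => p.1 i.castSucc, p.2), p.1 (Fin.last l))
  invFun p := (Fin.snoc p.1.1 p.2, p.1.2)
  left_inv p := Prod.ext (Fin.snoc_init_self p.1) rfl
  right_inv p := by simp

/-- Split off the first cell of a window. -/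
def consSplit (n k l : ℕ) : Pattern n k (l + 1) ≃ Fin n × Pattern n k l where
  toFun p := (p.1 0, (fun i => p.1 i.succ, p.2))
  invFun p := (Fin.cons p.1 p.2.1, p.2.2)
  left_inv p := Prod.ext (Fin.cons_self_tail p.1) rfl
  right_inv p := by simp

theorem winPerm_eq_snoc (a : ℤ) (l : ℕ) (σ : Equiv.Perm (Pattern n k l)) :
    winPerm a l σ = winPerm a (l + 1)
      ((snocSplit n k l).symm.permCongr (Equiv.prodCongr σ (Equiv.refl _))) := by
  ext1 c
  rw [winPerm_apply, winPerm_apply]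
  refine eq_writePat rfl ?_ fun u hu => writePat_fst_of_not fun h => hu (by push_cast; omega)
  rw [Equiv.permCongr_apply, Equiv.symm_symm, Equiv.eq_symm_apply]
  refine Prod.ext ?_ ?_
  · exact readPat_writePat a l c _
  · exact writePat_fst_of_not (by simp)

theorem winPerm_eq_cons (a : ℤ) (l : ℕ) (σ : Equiv.Perm (Pattern n k l)) :
    winPerm (a + 1) l σ = winPerm a (l + 1)
      ((consSplit n k l).symm.permCongr (Equiv.prodCongr (Equiv.refl _) σ)) := by
  ext1 c
  rw [winPerm_apply, winPerm_apply]
  have hr : ∀ c : Config n k, (consSplit n k l (readPat a (l + 1) c)).2 = readPat (a + 1) l c := by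
    intro c
    refine Prod.ext (funext fun i => ?_) rfl
    simp only [consSplit, readPat, Equiv.coe_fn_mk, Fin.val_succ]
    exact congrArg c.1 (by push_cast; ring)
  refine eq_writePat rfl ?_ fun u hu => writePat_fst_of_not fun h => hu (by push_cast; omega)
  rw [Equiv.permCongr_apply, Equiv.symm_symm, Equiv.eq_symm_apply]
  refine Prod.ext ?_ ?_
  · exact writePat_fst_of_not (by simp)
  · rw [hr, readPat_writePat]
    exact congrArg σ (hr c).symm

end Windows

/-! ### From one window to all larger windows -/

section Growth

open Equiv.Perm

variable {n k : ℕ}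

/-- The windows of length `l + 1` at `a` and `a + 1` share `l` cells and the state: a middle factor
with `n ^ l * k ≥ 5` elements. -/
theorem winPerm_mem_of_alternating (hn : 0 < n) {G : Subgroup (Equiv.Perm (Config n k))} {l : ℕ}
    (hl : 5 ≤ n ^ l * k)
    (h : ∀ a : ℤ, ∀ σ ∈ alternatingGroup (Pattern n k (l + 1)), winPerm a (l + 1) σ ∈ G)
    (a : ℤ) : ∀ σ ∈ alternatingGroup (Pattern n k (l + 2)), winPerm a (l + 2) σ ∈ G := by
  have : NeZero n := ⟨hn.ne'⟩
  let e : Pattern n k (l + 2) ≃ Fin n × Pattern n k l × Fin n :=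
    (consSplit n k (l + 1)).trans (Equiv.prodCongr (Equiv.refl _) (snocSplit n k l))
  let φ : Equiv.Perm (Fin n × Pattern n k l × Fin n) →* Equiv.Perm (Config n k) :=
    (winPerm a (l + 2)).comp e.symm.permCongrHom.toMonoidHom
  have hle : alternatingGroup (Fin n × Pattern n k l × Fin n) ≤ G.comap φ := by
    refine alternatingGroup_le_of_permFst_of_permSnd (by simpa using hl) _ ?_ ?_
    · intro σ hσ
      have h1 := h a ((consSplit n k l).symm.permCongr σ) (by
        rw [mem_alternatingGroup, sign_permCongr]
        exact hσ)
      rw [winPerm_eq_snoc] at h1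
      rw [Subgroup.mem_comap]
      refine (congrArg (· ∈ G) (congrArg (winPerm a (l + 2)) (Equiv.ext fun p => ?_))).mp h1
      exact Prod.ext (Fin.cons_snoc_eq_snoc_cons _ _ _).symm rfl
    · intro σ hσ
      have h1 := h (a + 1) ((snocSplit n k l).symm.permCongr σ) (by
        rw [mem_alternatingGroup, sign_permCongr]
        exact hσ)
      rw [winPerm_eq_cons] at h1
      rw [Subgroup.mem_comap]
      exact (congrArg (· ∈ G) (congrArg (winPerm a (l + 2)) (Equiv.ext fun p => rfl))).mp h1
  intro σ hσ
  have h1 := hle (x := e.permCongr σ) (by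
    rw [mem_alternatingGroup, sign_permCongr]
    exact hσ)
  rw [Subgroup.mem_comap] at h1
  convert h1 using 1
  simp only [φ, MonoidHom.comp_apply]
  congr 1
  ext1 p
  simp

theorem sign_prodCongr_refl {α β : Type*} [Fintype α] [DecidableEq α] [Fintype β]
    [DecidableEq β] (σ : Equiv.Perm α) :
    sign (Equiv.prodCongr σ (Equiv.refl β)) = sign σ ^ Fintype.card β := by
  have : Equiv.prodCongr σ (Equiv.refl β) = Equiv.prodCongrLeft fun _ => σ := by
    ext1 p
    rfl
  rw [this, sign_prodCongrLeft]
  simp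

/-- For even `n` every permutation becomes even on a window one cell longer. For odd `n` the sign
survives the extension, so an extended transposition supplies the missing odd element. -/
theorem winPerm_mem_of_base (hn : 0 < n) {G : Subgroup (Equiv.Perm (Config n k))} {l₀ : ℕ}
    (hl : 5 ≤ n ^ l₀ * k)
    (h : ∀ a : ℤ, ∀ σ : Equiv.Perm (Pattern n k (l₀ + 1)), winPerm a (l₀ + 1) σ ∈ G)
    {l : ℕ} (hll : l₀ + 1 ≤ l) (a : ℤ) (σ : Equiv.Perm (Pattern n k l)) : winPerm a l σ ∈ G := by
  have hpow : ∀ l, l₀ ≤ l → 5 ≤ n ^ l * k := fun l hl' =>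
    hl.trans (Nat.mul_le_mul_right _ (Nat.pow_le_pow_right hn hl'))
  have hk : 0 < k := Nat.pos_of_ne_zero (by rintro rfl; simp at hl)
  rcases Nat.even_or_odd n with he | ho
  · have halt : ∀ l, l₀ + 1 ≤ l → ∀ a : ℤ, ∀ σ ∈ alternatingGroup (Pattern n k l),
        winPerm a l σ ∈ G := by
      intro l hl'
      induction l, hl' using Nat.le_induction with
      | base => exact fun a σ _ => h a σ
      | succ l hl' ih =>
        obtain ⟨l, rfl⟩ := Nat.exists_eq_add_of_le' (show 1 ≤ l by omega)
        exact winPerm_mem_of_alternating hn (hpow l (by omega)) ih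
    rw [winPerm_eq_snoc]
    refine halt (l + 1) (by omega) a _ ?_
    rw [mem_alternatingGroup, sign_permCongr, sign_prodCongr_refl, Fintype.card_fin]
    rcases Int.units_eq_one_or (sign σ) with h1 | h1 <;> simp [h1, he.neg_one_pow]
  · induction l, hll using Nat.le_induction generalizing a with
    | base => exact h a σ
    | succ l hl' ih =>
      obtain ⟨l, rfl⟩ := Nat.exists_eq_add_of_le' (show 1 ≤ l by omega)
      have halt := winPerm_mem_of_alternating hn (hpow l (by omega)) fun a σ _ => ih a σ
      rcases Int.units_eq_one_or (sign σ) with h1 | h1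
      · exact halt a σ h1
      · have : Nontrivial (Pattern n k (l + 1)) := by
          rw [← Fintype.one_lt_card_iff_nontrivial]
          have := hpow (l + 1) (by omega)
          simp only [Fintype.card_prod, Fintype.card_pi, Fintype.card_fin, Finset.prod_const,
            Finset.card_univ]
          omega
        obtain ⟨x, y, hxy⟩ := exists_pair_ne (Pattern n k (l + 1))
        have h2 := ih a (Equiv.swap x y)
        rw [winPerm_eq_snoc] at h2
        refine (Subgroup.mul_mem_cancel_right G h2).1 ?_
        rw [← map_mul]
        refine halt a _ ?_
        rw [mem_alternatingGroup, Equiv.Perm.sign_mul, sign_permCongr, sign_prodCongr_refl, sign_swap hxy, h1,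
          Fintype.card_fin, ho.neg_one_pow]
        rfl

/-- The local permutations are generated by those on one window and by `step`. -/
theorem LP_le [NeZero n] [NeZero k] {G : Subgroup (Equiv.Perm (Config n k))}
    (hstep : step n k ∈ G) (h : ∀ σ : Equiv.Perm (Pattern n k 4), winPerm 0 4 σ ∈ G) :
    LP n k ≤ G := by
  intro T hT
  rcases Nat.lt_or_ge 1 n with hn | hn
  · obtain ⟨m₀, hm₀⟩ := exists_winPerm_eq_of_mem_LP hT
    obtain ⟨σ, rfl⟩ := hm₀ (m₀ + 2) (by omega)
    -- With `n ≥ 2`, three shared cells give at least 8 patterns even for `k = 1`; two would give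
    -- only 4 when `n = 2`.
    refine winPerm_mem_of_base (l₀ := 3) (by omega) ?_ (fun a τ => ?_) (by omega) _ σ
    · have h1 : 2 ^ 3 ≤ n ^ 3 := Nat.pow_le_pow_left hn 3
      have h2 := NeZero.pos k
      nlinarith
    · rw [winPerm_eq_conj]
      exact mul_mem (mul_mem (zpow_mem hstep _) (h τ)) (zpow_mem hstep _)
  · obtain ⟨σ, rfl⟩ := exists_winPerm_eq_of_subsingleton
      (by have := NeZero.pos n; omega) hT 0 4
    exact h σ

end Growth

/-! ### Local sets as finite unions of cylinders -/

section Cylinders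

variable {n k : ℕ}

/-- The configurations whose pattern up to distance `m` from the head is `p`. -/
def cylinder (m : ℕ) (p : Pattern n k (2 * m + 1)) : Set (Config n k) :=
  {c | readPat (-m) (2 * m + 1) c = p}

theorem mem_cylinder {m : ℕ} {p : Pattern n k (2 * m + 1)} {c : Config n k} :
    c ∈ cylinder m p ↔ readPat (-m) (2 * m + 1) c = p := Iff.rfl

theorem mem_biUnion_cylinder {m : ℕ} {B : Finset (Pattern n k (2 * m + 1))} {c : Config n k} :
    c ∈ ⋃ p ∈ B, cylinder m p ↔ readPat (-m) (2 * m + 1) c ∈ B := by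
  simp [mem_cylinder]

theorem pairwise_disjoint_cylinder (m : ℕ) :
    Pairwise (Function.onFun Disjoint (cylinder (n := n) (k := k) m)) := fun _ _ h =>
  Set.disjoint_left.2 fun _ h1 h2 => h ((mem_cylinder.1 h1).symm.trans h2)

theorem isLocal_mem_cylinder (m : ℕ) (p : Pattern n k (2 * m + 1)) :
    IsLocal (· ∈ cylinder m p) :=
  ⟨m, fun c c' h => by
    dsimp only
    rw [mem_cylinder, mem_cylinder, readPat_eq_iff_agree.2 h]⟩

theorem cylinder_nonempty [NeZero n] (m : ℕ) (p : Pattern n k (2 * m + 1)) :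
    (cylinder m p).Nonempty :=
  ⟨writePat (-m) (2 * m + 1) (fun _ => 0, p.2, 0) p, readPat_writePat _ _ _ _⟩

theorem IsLocal.exists_eq_biUnion_cylinder {P : Set (Config n k)} (hP : IsLocal (· ∈ P)) :
    ∃ m₀ : ℕ, ∀ m, m₀ ≤ m →
      ∃ B : Finset (Pattern n k (2 * m + 1)), P = ⋃ p ∈ B, cylinder m p := by
  classical
  obtain ⟨m₀, hm₀⟩ := hP
  refine ⟨m₀, fun m hm =>
    ⟨Finset.univ.filter fun p => ∃ c ∈ P, readPat (-m) (2 * m + 1) c = p, ?_⟩⟩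
  ext c
  rw [mem_biUnion_cylinder, Finset.mem_filter_univ]
  refine ⟨fun h => ⟨c, h, rfl⟩, ?_⟩
  rintro ⟨d, hd, h⟩
  exact (hm₀ d c ((readPat_eq_iff_agree.1 h).mono hm)).mp hd

theorem image_winPerm_swap (m : ℕ) (p p' : Pattern n k (2 * m + 1)) :
    winPerm (-m : ℤ) (2 * m + 1) (Equiv.swap p p') '' cylinder m p = cylinder m p' := by
  have hr : ∀ c : Config n k,
      readPat (-m) (2 * m + 1) (winPerm (-m : ℤ) (2 * m + 1) (Equiv.swap p p') c) =
        Equiv.swap p p' (readPat (-m) (2 * m + 1) c) := fun c => by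
    rw [winPerm_apply, readPat_writePat]
  ext c
  constructor
  · rintro ⟨d, hd, rfl⟩
    rw [mem_cylinder, hr, mem_cylinder.1 hd, Equiv.swap_apply_left]
  · intro hc
    refine ⟨winPerm (-m : ℤ) (2 * m + 1) (Equiv.swap p p') c, ?_, ?_⟩
    · rw [mem_cylinder, hr, mem_cylinder.1 hc, Equiv.swap_apply_right]
    · rw [← Equiv.Perm.mul_apply, ← map_mul, Equiv.swap_mul_self, map_one, Equiv.Perm.one_apply]

theorem winPerm_swap_of_notMem {m : ℕ} {p p' : Pattern n k (2 * m + 1)} {c : Config n k}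
    (h : c ∉ cylinder m p) (h' : c ∉ cylinder m p') :
    winPerm (-m : ℤ) (2 * m + 1) (Equiv.swap p p') c = c := by
  rw [winPerm_apply, Equiv.swap_apply_of_ne_of_ne h h', writePat_readPat]

theorem readPat_apply (m : ℕ) (c : Config n k) (i : ℤ) (hi : |i| ≤ m) :
    (readPat (-m) (2 * m + 1) c).1 ⟨(i + m).toNat, by rw [abs_le] at hi; omega⟩ =
      c.1 (c.2.2 + i) := by
  rw [abs_le] at hi
  have h2 : ((i + m).toNat : ℤ) = i + m := Int.toNat_of_nonneg (by omega)
  simp only [readPat, h2]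
  exact congrArg c.1 (by ring)

end Cylinders

/-! ### All adjacent swaps from the basic ones -/

section Generation

variable {n k : ℕ} [NeZero k]

/-- The last state. -/
def lastState (k : ℕ) [NeZero k] : Fin k := ⟨k - 1, Nat.sub_lt (NeZero.pos k) one_pos⟩

theorem step_of_state_eq {c : Config n k} (hc : c.2.1 = lastState k) :
    step n k c = (c.1, 0, c.2.2 + 1) := by
  refine ext_pos rfl ?_
  have := NeZero.pos k
  rw [step_apply, pos_move]
  simp only [pos, hc, lastState]
  rw [Nat.cast_pred this, Fin.val_zero]
  push_cast
  ring

theorem step_head_of_state_ne {c : Config n k} (hc : c.2.1 ≠ lastState k) :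
    (step n k c).2.2 = c.2.2 := by
  have h1 : (c.2.1 : ℕ) ≠ k - 1 := fun h => hc (Fin.ext h)
  have h2 := c.2.1.2
  change c.2.2 + (((c.2.1 : ℕ) : ℤ) + 1) / k = c.2.2
  rw [Int.ediv_eq_zero_of_lt (by positivity) (by omega), add_zero]

theorem lastState_ne_zero (hk : 2 ≤ k) : lastState k ≠ 0 := by
  intro h
  have := congrArg Fin.val h
  simp only [lastState, Fin.val_zero] at this
  omega

/-- `step` moves the head only when it leaves the last state. -/
theorem adjSwap_step_mem_LP {P : Set (Config n k)} (hP : IsLocal (· ∈ P))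
    (hstate : ∀ c ∈ P, c.2.1 ≠ lastState k) : adjSwap (step n k) P ∈ LP n k := by
  refine ⟨(adjSwap_step_mem_RFA hP).1, fun c => ?_⟩
  by_cases h : Separated (step n k) P
  · by_cases h1 : c ∈ P
    · rw [adjSwap_of_mem h h1, step_head_of_state_ne (hstate c h1)]
    by_cases h2 : (step n k).symm c ∈ P
    · have := step_head_of_state_ne (hstate _ h2)
      rw [Equiv.apply_symm_apply] at this
      rw [adjSwap_of_symm_mem h h2, this]
    · rw [adjSwap_of_notMem h1 h2]
  · rw [adjSwap, dif_neg h]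
    rfl

/-- The configurations in the last state with two given symbols at the head and to its right. -/
def basic (a b : Fin n) : Set (Config n k) :=
  {c | c.2.1 = lastState k ∧ c.1 c.2.2 = a ∧ c.1 (c.2.2 + 1) = b}

theorem isLocal_mem_basic (a b : Fin n) : IsLocal (· ∈ (basic a b : Set (Config n k))) := by
  have h := (isLocal_state.map (· = lastState k)).map₂
    (((isLocal_tape (n := n) (k := k) 0).map (· = a)).map₂ ((isLocal_tape 1).map (· = b)) And) And
  simp only [add_zero] at h
  exact h

theorem separated_of_state {P : Set (Config n k)} (hk : 2 ≤ k)
    (hP : ∀ c ∈ P, c.2.1 = lastState k) : Separated (step n k) P := fun c hc hc' => by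
  have := hP _ hc'
  rw [step_of_state_eq (hP c hc)] at this
  exact lastState_ne_zero hk this.symm

/-- The pattern that has the symbol `a` in the last cell and the symbol `d` elsewhere. -/
def markerPat (k : ℕ) [NeZero k] (m : ℕ) (a d : Fin n) : Pattern n k (2 * m + 1) :=
  (fun j => if (j : ℕ) = 2 * m then a else d, lastState k)

theorem apply_of_mem_cylinder_markerPat {m : ℕ} {a d : Fin n} {c : Config n k}
    (hc : c ∈ cylinder m (markerPat k m a d)) (i : ℤ) (hi : |i| ≤ m) :
    c.1 (c.2.2 + i) = if i = m then a else d := by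
  rw [← readPat_apply m c i hi, mem_cylinder.1 hc]
  rw [abs_le] at hi
  simp only [markerPat]
  congr 1
  exact propext (by omega)

theorem disjoint_basic_markerPat {m : ℕ} (hm : 1 ≤ m) {a b d : Fin n} (hd : d ≠ a) :
    Disjoint (basic a b : Set (Config n k)) (cylinder m (markerPat k m a d)) := by
  refine Set.disjoint_left.2 fun c h1 h2 => hd ?_
  have := apply_of_mem_cylinder_markerPat h2 0 (by simp)
  rw [add_zero, if_neg (by omega), h1.2.1] at this
  exact this.symm

/-- For `k ≥ 2` the state alone separates. For `k = 1` the tape must do it: the choice `d = b`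
excludes two consecutive basic configurations, and the odd symbol at the edge of the marker excludes
two consecutive markers. -/
theorem separated_basic_union {m : ℕ} (hm : 3 ≤ m) {a b d : Fin n} (hd : d ≠ a)
    (h : 2 ≤ k ∨ d = b) :
    Separated (step n k) (basic a b ∪ cylinder m (markerPat k m a d)) := by
  have hstate : ∀ c : Config n k, c ∈ basic a b ∪ cylinder m (markerPat k m a d) →
      c.2.1 = lastState k := by
    rintro c (hc | hc)
    · exact hc.1
    · exact (Prod.ext_iff.1 (mem_cylinder.1 hc)).2
  rcases h with hk | rfl
  · exact separated_of_state hk hstate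
  · intro c hc hc'
    rw [step_of_state_eq (hstate c hc)] at hc'
    have key : ∀ c : Config n k, c ∈ cylinder m (markerPat k m a d) → ∀ i : ℤ, -3 ≤ i → i < m →
        c.1 (c.2.2 + i) = d := by
      intro c hc i h1 h2
      rw [apply_of_mem_cylinder_markerPat hc i (by rw [abs_le]; omega), if_neg (by omega)]
    rcases hc with hc | hc <;> rcases hc' with hc' | hc'
    · exact hd (hc.2.2.symm.trans hc'.2.1)
    · have := key _ hc' (-1) (by omega) (by omega)
      simp only [add_neg_cancel_right] at this
      exact hd (this.symm.trans hc.2.1)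
    · have := key _ hc 1 (by omega) (by omega)
      exact hd (this.symm.trans hc'.2.1)
    · have h1 := apply_of_mem_cylinder_markerPat hc m (by simp)
      have h2 := key _ hc' (m - 1) (by omega) (by omega)
      rw [if_pos rfl] at h1
      simp only [add_assoc, add_sub_cancel] at h2
      exact hd (h2.symm.trans h1)

/-- With one state, the cylinder of a constant pattern contains a constant tape with the head
anywhere, hence is not separated. -/
theorem exists_ne_of_separated {m : ℕ} {p : Pattern n k (2 * m + 1)} (hm : 1 ≤ m)
    (hp : p.2 = lastState k) (hsep : Separated (step n k) (cylinder m p)) :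
    ∃ j : Fin (2 * m), 2 ≤ k ∨ p.1 j.castSucc ≠ p.1 j.succ := by
  by_contra! hcon
  have hk : k = 1 := by
    have := (hcon ⟨0, by omega⟩).1
    have := NeZero.pos k
    omega
  subst hk
  have hconst : ∀ j, p.1 j = p.1 0 := fun j => by
    induction j using Fin.induction with
    | zero => rfl
    | succ j ih => rw [← (hcon j).2, ih]
  have hc : ∀ v : ℤ, ((fun _ => p.1 0, lastState 1, v) : Config n 1) ∈ cylinder m p := fun v =>
    Prod.ext (funext fun j => (hconst j).symm) (Subsingleton.elim _ _)
  refine hsep _ (hc 0) ?_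
  rw [step_of_state_eq rfl]
  exact hc (0 + 1)

variable {G : Subgroup (Equiv.Perm (Config n k))}

theorem adjSwap_cylinder_mul_mem (hstep : step n k ∈ G) (hLP : LP n k ≤ G)
    (hbasic : ∀ a b : Fin n, adjSwap (step n k) (basic a b) ∈ G) {m : ℕ} (hm : 3 ≤ m)
    {a b d : Fin n} (hd : d ≠ a) (h : 2 ≤ k ∨ d = b) {p : Pattern n k (2 * m + 1)}
    (hp : cylinder m p ⊆ basic a b) :
    adjSwap (step n k) (cylinder m p) *
      adjSwap (step n k) (cylinder m (markerPat k m a d)) ∈ G :=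
  adjSwap_mul_adjSwap_mem hstep (hLP (winPerm_mem_LP _ _ _)) (hbasic a b) hp
    (disjoint_basic_markerPat (by omega) hd) (separated_basic_union hm hd h)
    (image_winPerm_swap m p _) fun _ => winPerm_swap_of_notMem

/-- Each cylinder costs one marker swap. The marker swap is an involution, so only the parity of
`B.card` matters. -/
theorem adjSwap_biUnion_cylinder_mul_pow_mem (hstep : step n k ∈ G) (hLP : LP n k ≤ G)
    (hbasic : ∀ a b : Fin n, adjSwap (step n k) (basic a b) ∈ G) {m : ℕ} (hm : 3 ≤ m)
    {a b d : Fin n} (hd : d ≠ a) (h : 2 ≤ k ∨ d = b) {B : Finset (Pattern n k (2 * m + 1))}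
    (hB : (⋃ p ∈ B, cylinder m p) ⊆ basic a b) :
    adjSwap (step n k) (⋃ p ∈ B, cylinder m p) *
      adjSwap (step n k) (cylinder m (markerPat k m a d)) ^ B.card ∈ G := by
  have hsep := separated_basic_union hm hd h
  have hsub : ∀ p ∈ B, cylinder m p ⊆ basic a b := fun p hp =>
    (Set.subset_biUnion_of_mem (u := fun p => cylinder m p) hp).trans hB
  refine adjSwap_biUnion_mul_pow_mem G _ B _ (hsep.mono (hB.trans Set.subset_union_left))
    (pairwise_disjoint_cylinder m) (fun p hp => ?_)
    fun p hp => adjSwap_cylinder_mul_mem hstep hLP hbasic hm hd h (hsub p hp)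
  exact adjSwap_commute (hsep.mono (Set.union_subset_union_left _ (hsub p hp)))
    ((disjoint_basic_markerPat (by omega) hd).mono_left (hsub p hp))

theorem adjSwap_pow_of_even {X : Type*} (N : Equiv.Perm X) (P : Set X) {j : ℕ} (hj : Even j) :
    adjSwap N P ^ j = 1 := by
  obtain ⟨i, rfl⟩ := hj
  rw [← two_mul, pow_mul, pow_two, adjSwap_mul_self, one_pow]

variable [NeZero n]

/-- The marker swap is eliminated by counting cylinders modulo 2. -/
theorem adjSwap_cylinder_mem_of_subset_basic (hstep : step n k ∈ G) (hLP : LP n k ≤ G)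
    (hbasic : ∀ a b : Fin n, adjSwap (step n k) (basic a b) ∈ G) {m : ℕ} (hm : 3 ≤ m)
    {a b : Fin n} (h : 2 ≤ k ∨ a ≠ b) {p : Pattern n k (2 * m + 1)}
    (hp : cylinder m p ⊆ basic a b) : adjSwap (step n k) (cylinder m p) ∈ G := by
  have hp2 : p.2 = lastState k := by
    obtain ⟨c, hc⟩ := cylinder_nonempty m p
    rw [← (hp hc).1, ← mem_cylinder.1 hc]
    rfl
  rcases Nat.lt_or_ge 1 n with hn | hn
  · obtain ⟨d, hd, h⟩ : ∃ d : Fin n, d ≠ a ∧ (2 ≤ k ∨ d = b) := by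
      by_cases hab : a = b
      · have : Nontrivial (Fin n) := Fin.nontrivial_iff_two_le.2 hn
        obtain ⟨d, hd⟩ := exists_ne a
        exact ⟨d, hd, Or.inl (h.resolve_right (by simpa using hab))⟩
      · exact ⟨b, Ne.symm hab, Or.inr rfl⟩
    rcases Nat.even_or_odd n with he | ho
    -- Enlarge the window by a free cell on each side: the cylinder splits into an even number of
    -- cylinders and the marker swaps cancel.
    · let t : Fin (2 * (m + 1) + 1) → Finset (Fin n) := fun j =>
        if hj : 0 < (j : ℕ) ∧ (j : ℕ) < 2 * m + 2 then {p.1 ⟨j - 1, by omega⟩} else Finset.univ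
      let B : Finset (Pattern n k (2 * (m + 1) + 1)) := Fintype.piFinset t ×ˢ {lastState k}
      have hB : cylinder m p = ⋃ q ∈ B, cylinder (m + 1) q := by
        ext c
        rw [mem_biUnion_cylinder, Finset.mem_product, Fintype.mem_piFinset,
          Finset.mem_singleton, mem_cylinder]
        have hcell : ∀ j : Fin (2 * m + 1),
            (readPat (-(m + 1 : ℕ)) (2 * (m + 1) + 1) c).1 ⟨j + 1, by omega⟩ =
              (readPat (-m) (2 * m + 1) c).1 j := fun j => by
          simp only [readPat]
          exact congrArg c.1 (by push_cast; ring)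
        constructor
        · rintro rfl
          refine ⟨fun j => ?_, hp2⟩
          simp only [t]
          split_ifs with hj
          · rw [Finset.mem_singleton, ← hcell]
            exact congrArg _ (Fin.ext (by dsimp only; omega))
          · exact Finset.mem_univ _
        · rintro ⟨h1, h2⟩
          refine Prod.ext (funext fun j => ?_) (h2.trans hp2.symm)
          have h3 := h1 ⟨j + 1, by omega⟩
          simp only [t] at h3
          rw [dif_pos (by omega), Finset.mem_singleton, hcell] at h3
          exact h3
      have hcard : Even B.card := by
        rw [Finset.card_product, Fintype.card_piFinset, Finset.card_singleton, mul_one,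
          even_iff_two_dvd]
        refine Dvd.dvd.trans ?_ (Finset.dvd_prod_of_mem _ (Finset.mem_univ 0))
        simpa [t] using he.two_dvd
      have h1 := adjSwap_biUnion_cylinder_mul_pow_mem hstep hLP hbasic (m := m + 1) (by omega) hd h
        (B := B) (hB ▸ hp)
      rwa [adjSwap_pow_of_even _ _ hcard, mul_one, ← hB] at h1
    -- Here `basic a b` consists of an odd number of cylinders. Its swap is in `G`, so the marker
    -- swap itself is in `G`.
    · let t : Fin (2 * m + 1) → Finset (Fin n) := fun j =>
        if (j : ℕ) = m then {a} else if (j : ℕ) = m + 1 then {b} else Finset.univ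
      let B : Finset (Pattern n k (2 * m + 1)) := Fintype.piFinset t ×ˢ {lastState k}
      have hB : basic a b = ⋃ q ∈ B, cylinder m q := by
        ext c
        rw [mem_biUnion_cylinder, Finset.mem_product, Fintype.mem_piFinset,
          Finset.mem_singleton]
        have h0 := readPat_apply m c 0 (by simp)
        have h1 := readPat_apply m c 1 (by rw [abs_one]; omega)
        rw [add_zero] at h0
        constructor
        · rintro ⟨h2, h3, h4⟩
          refine ⟨fun j => ?_, h2⟩
          simp only [t]
          split_ifs with hj hj
          · rw [Finset.mem_singleton, ← h3, ← h0]
            exact congrArg _ (Fin.ext (by dsimp only; omega))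
          · rw [Finset.mem_singleton, ← h4, ← h1]
            exact congrArg _ (Fin.ext (by dsimp only; omega))
          · exact Finset.mem_univ _
        · rintro ⟨h2, h3⟩
          refine ⟨h3, ?_, ?_⟩
          · rw [← h0]
            have := h2 ⟨(0 + m : ℤ).toNat, by omega⟩
            simp only [t] at this
            rw [if_pos (by omega), Finset.mem_singleton] at this
            exact this
          · rw [← h1]
            have := h2 ⟨(1 + m : ℤ).toNat, by omega⟩
            simp only [t] at this
            rw [if_neg (by omega), if_pos (by omega), Finset.mem_singleton] at this
            exact this
      have hcard : Odd B.card := by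
        rw [Finset.card_product, Fintype.card_piFinset, Finset.card_singleton, mul_one]
        refine Finset.prod_induction _ Odd (fun _ _ => Odd.mul) odd_one fun j _ => ?_
        simp only [t]
        split_ifs <;> simp [ho]
      have h1 := adjSwap_biUnion_cylinder_mul_pow_mem hstep hLP hbasic hm hd h
        (B := B) hB.symm.subset
      obtain ⟨i, hi⟩ := hcard
      rw [← hB, hi, pow_succ, adjSwap_pow_of_even _ _ (even_two_mul i), one_mul] at h1
      have h2 := (Subgroup.mul_mem_cancel_left G (hbasic a b)).1 h1
      exact (Subgroup.mul_mem_cancel_right G h2).1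
        (adjSwap_cylinder_mul_mem hstep hLP hbasic hm hd h hp)
  · have hn1 : n = 1 := by
      have := NeZero.pos n
      omega
    subst hn1
    have : cylinder m p = basic a b := hp.antisymm fun c hc =>
      Prod.ext (Subsingleton.elim _ _) (hc.1.trans hp2.symm)
    rw [this]
    exact hbasic a b

theorem adjSwap_mem_of_subset_basic (hstep : step n k ∈ G) (hLP : LP n k ≤ G)
    (hbasic : ∀ a b : Fin n, adjSwap (step n k) (basic a b) ∈ G)
    {a b : Fin n} (h : 2 ≤ k ∨ a ≠ b) {P : Set (Config n k)} (hP : IsLocal (· ∈ P))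
    (hsep : Separated (step n k) P) (hPab : P ⊆ basic a b) : adjSwap (step n k) P ∈ G := by
  obtain ⟨m₀, hm₀⟩ := hP.exists_eq_biUnion_cylinder
  obtain ⟨B, rfl⟩ := hm₀ (m₀ + 3) (by omega)
  refine adjSwap_biUnion_mem G B _ hsep (pairwise_disjoint_cylinder _) fun p hp => ?_
  exact adjSwap_cylinder_mem_of_subset_basic hstep hLP hbasic (by omega) h
    ((Set.subset_biUnion_of_mem (u := fun p => cylinder (m₀ + 3) p) hp).trans hPab)

/-- All adjacent swaps are generated by `step`, the local permutations and the basic swaps. -/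
theorem adjSwap_mem (hstep : step n k ∈ G) (hLP : LP n k ≤ G)
    (hbasic : ∀ a b : Fin n, adjSwap (step n k) (basic a b) ∈ G)
    {P : Set (Config n k)} (hP : IsLocal (· ∈ P)) (hsep : Separated (step n k) P) :
    adjSwap (step n k) P ∈ G := by
  obtain ⟨m₀, hm₀⟩ := hP.exists_eq_biUnion_cylinder
  obtain ⟨B, rfl⟩ := hm₀ (m₀ + 1) (by omega)
  refine adjSwap_biUnion_mem G B _ hsep (pairwise_disjoint_cylinder _) fun p hp => ?_
  replace hsep := hsep.mono
    (Set.subset_biUnion_of_mem (u := fun p => cylinder (m₀ + 1) p) hp)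
  generalize hm : m₀ + 1 = m at *
  by_cases hp2 : p.2 = lastState k
  · obtain ⟨j, hj⟩ := exists_ne_of_separated (by omega) hp2 hsep
    -- The window starts `m` cells to the left of the head, so moving the head by `i` puts it on
    -- cell `j`, with the symbols `p.1 j.castSucc` and `p.1 j.succ` at the head and to its right.
    set i : ℤ := (j : ℕ) - m with hi
    have hM : ∀ (e : ℤ) (c : Config n k),
        (step n k ^ ((k : ℤ) * e)) c = (c.1, c.2.1, c.2.2 + e) := fun e c => by
      rw [step_zpow_apply, move_mul]
    set M := step n k ^ ((k : ℤ) * i) with hMdef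
    have hcomm : Commute M (step n k) := (Commute.refl _).zpow_left _
    have hconj := conj_adjSwap_of_commute hsep hcomm
    have himg : ∀ c, c ∈ M '' cylinder m p ↔ move (k * (-i)) c ∈ cylinder m p := by
      intro c
      have h1 : M (move (k * (-i)) c) = c := by
        rw [hMdef, step_zpow_apply, move_move]
        simp
      refine ⟨?_, fun h => ⟨_, h, h1⟩⟩
      rintro ⟨d, hd, rfl⟩
      rwa [← M.injective h1.symm]
    have hmem : adjSwap (step n k) (M '' cylinder m p) ∈ G := by
      refine adjSwap_mem_of_subset_basic hstep hLP hbasic hj ?_ ?_ ?_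
      · have h1 := (isLocal_mem_cylinder m p).comp_move (k * (-i))
        convert h1 using 2 with c
        exact himg c
      · rintro _ ⟨c, hc, rfl⟩ ⟨d, hd, h⟩
        have h1 := congrArg (fun f : Equiv.Perm (Config n k) => f c) hcomm.eq
        simp only [Equiv.Perm.mul_apply] at h1
        rw [← h1, M.injective.eq_iff] at h
        exact hsep c hc (h ▸ hd)
      · rintro _ ⟨c, hc, rfl⟩
        rw [hMdef, hM]
        rw [mem_cylinder] at hc
        subst hc
        refine ⟨hp2, ?_, ?_⟩
        · simp only [readPat, Fin.val_castSucc]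
          exact congrArg c.1 (by rw [hi]; ring)
        · simp only [readPat, Fin.val_succ]
          exact congrArg c.1 (by rw [hi]; push_cast; ring)
    rw [← hconj] at hmem
    have hMG : M ∈ G := zpow_mem hstep _
    exact (Subgroup.mul_mem_cancel_left G hMG).1
      ((Subgroup.mul_mem_cancel_right G (inv_mem hMG)).1 hmem)
  · refine hLP (adjSwap_step_mem_LP (isLocal_mem_cylinder m p) fun c hc => ?_)
    rw [mem_cylinder] at hc
    subst hc
    exact hp2

end Generation

end MovingHead

theorem mainTheorem1 (n k : ℕ) (hn : 1 ≤ n) (hk : 1 ≤ k) :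
    Group.FG (MovingHead.EL n k) := by
  open MovingHead in
  have : NeZero n := ⟨by omega⟩
  have : NeZero k := ⟨by omega⟩
  -- When `k = 1`, the set `basic a a` is not separated and its swap is the identity by convention,
  -- so no pair of symbols has to be left out.
  let S : Set (Equiv.Perm (Config n k)) :=
    {step n k} ∪ Set.range (fun σ : Equiv.Perm (Pattern n k 4) => winPerm 0 4 σ) ∪
      Set.range (fun s : Fin n × Fin n => adjSwap (step n k) (basic s.1 s.2))
  have hS : S.Finite := ((Set.finite_singleton _).union (Set.finite_range _)).union
    (Set.finite_range _)
  have hEL : EL n k = Subgroup.closure S := by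
    refine le_antisymm ?_ ?_
    · have hstep : step n k ∈ Subgroup.closure S :=
        Subgroup.subset_closure (Or.inl (Or.inl rfl))
      have hLP : LP n k ≤ Subgroup.closure S :=
        LP_le hstep fun σ => Subgroup.subset_closure (Or.inl (Or.inr ⟨σ, rfl⟩))
      have hRFA : RFA n k ≤ Subgroup.closure S := RFA_le hstep fun P hP hsep =>
        adjSwap_mem hstep hLP (fun a b => Subgroup.subset_closure (Or.inr ⟨(a, b), rfl⟩)) hP hsep
      exact (Subgroup.closure_le _).2 (Set.union_subset hRFA hLP)
    · refine (Subgroup.closure_le _).2 ?_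
      rintro _ ((rfl | ⟨σ, rfl⟩) | ⟨s, rfl⟩)
      · exact Subgroup.subset_closure (Or.inl step_mem_RFA)
      · exact Subgroup.subset_closure (Or.inr (winPerm_mem_LP 0 4 σ))
      · exact Subgroup.subset_closure (Or.inl (adjSwap_step_mem_RFA (isLocal_mem_basic _ _)))
  rw [Group.fg_iff_subgroup_fg, hEL]
  exact (Subgroup.fg_iff _).2 ⟨S, rfl, hS⟩
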